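/- Let $b>0$, $\omega>0$, $\alpha>-1$ be real and let $m\in\mathbb{C}$ satisfy $\operatorname{Re}(m)>-1$ and $\alpha+\operatorname{Re}(m)>-1$. Let $J_m$ be the Bessel function of the first kind of order $m$, and put $$I_1[f]=\int_0^b x^\alpha f(x)J_m(\omega x)\,dx,\qquad I_2[f]=\int_0^b x^\alpha \ln(x)f(x)J_m(\omega x)\,dx .$$ For $N\ge 1$ let $P_Nf$ be the polynomial of degree at most $N$ that interpolates $f$ at the Clenshaw-Curtis points $x_j=\frac b2+\frac b2\cos\left(\frac{j\pi}{N}\right)$, $j=0,\dots,N$. The Clenshaw-Curtis-Filon (CCF) approximations are $I_1^{CCF}[f]=I_1[P_Nf]$ and $I_2^{CCF}[f]=I_2[P_Nf]$. Let $k\ge 1$ be an integer and let $f:[0,b]\to\mathbb{C}$ have an absolutely continuous $(k-1)$-st derivative $f^{(k-1)}$ on $[0,b]$ and a $k$-th derivative $f^{(k)}$ of bounded variation (that is, the almost everywhere derivative of $f^{(k-1)}$ agrees almost everywhere with a function of bounded variation on $[0,b]$). Then $$|I_1[f]-I_1^{CCF}[f]|=\begin{cases}O\left(N^{-(k+2\alpha+2)}\right),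 & -1<\alpha<-\tfrac12,\\ O\left(N^{-(k+1)}\right), & \alpha\ge-\tfrac12,\end{cases}$$ $$|I_2[f]-I_2^{CCF}[f]|=\begin{cases}O\left(\ln (N)\,N^{-(k+2\alpha+2)}\right), & -1<\alpha<-\tfrac12,\\ O\left(\ln (N)\,N^{-(k+1)}\right), & \alpha=-\tfrac12,\\ O\left(N^{-(k+1)}\right), & \alpha>-\tfrac12.\end{cases}$$ Here each $O$ bound holds for all integers $N\ge k$ (and $N\ge2$ in the two bounds that contain $\ln N$), with a constant that does not depend on $N$ but may depend on $b,\omega,\alpha,m,k,f$. -/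

import Mathlib

noncomputable section

/-- Bessel function of the first kind of complex order `ν`, by its power series
`J_ν(z) = (z/2)^ν ∑ₙ (-1)ⁿ (z/2)^(2n) / (n! Γ(n + ν + 1))`, with the principal branch of the
power.  `Complex.Gamma` takes the value `0` at its poles, so the terms with `1 / Γ(-j)` vanish, as
they should. -/
def besselJ (ν z : ℂ) : ℂ :=
  (z / 2) ^ ν *
    ∑' n : ℕ, (-1 : ℂ) ^ n / ((n.factorial : ℂ) * Complex.Gamma (n + ν + 1)) * (z / 2) ^ (2 * n)

/-- The Clenshaw-Curtis points `x_j = b/2 + (b/2) cos(jπ/N)` on `[0, b]`. -/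
def clenshawCurtisPoint (b : ℝ) (N j : ℕ) : ℝ :=
  b / 2 + b / 2 * Real.cos (j * Real.pi / N)

/-- The polynomial of degree at most `N` which interpolates `f` in the Clenshaw-Curtis points
`x_0, …, x_N` (these are distinct for `b > 0` and `N ≥ 1`). -/
def ccInterpolant (b : ℝ) (N : ℕ) (f : ℝ → ℂ) : Polynomial ℂ :=
  Lagrange.interpolate (Finset.range (N + 1)) (fun j => (clenshawCurtisPoint b N j : ℂ))
    (fun j => f (clenshawCurtisPoint b N j))

/-- `I₁[f] = ∫₀ᵇ x^α f(x) J_m(ωx) dx`. -/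
def besselTransform (b α ω : ℝ) (m : ℂ) (f : ℝ → ℂ) : ℂ :=
  ∫ x in (0 : ℝ)..b, ((x ^ α : ℝ) : ℂ) * f x * besselJ m ((ω * x : ℝ) : ℂ)

/-- `I₂[f] = ∫₀ᵇ x^α ln(x) f(x) J_m(ωx) dx`. -/
def besselLogTransform (b α ω : ℝ) (m : ℂ) (f : ℝ → ℂ) : ℂ :=
  ∫ x in (0 : ℝ)..b, ((x ^ α * Real.log x : ℝ) : ℂ) * f x * besselJ m ((ω * x : ℝ) : ℂ)

/-- The Clenshaw-Curtis-Filon approximation of `I₁[f]`: `f` is replaced by its interpolant. -/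
def ccf (b α ω : ℝ) (m : ℂ) (N : ℕ) (f : ℝ → ℂ) : ℂ :=
  besselTransform b α ω m (fun x => (ccInterpolant b N f).eval (x : ℂ))

/-- The Clenshaw-Curtis-Filon approximation of `I₂[f]`: `f` is replaced by its interpolant. -/
def ccfLog (b α ω : ℝ) (m : ℂ) (N : ℕ) (f : ℝ → ℂ) : ℂ :=
  besselLogTransform b α ω m (fun x => (ccInterpolant b N f).eval (x : ℂ))

/-- `f` has an absolutely continuous `(k-1)`-st derivative on `[0, b]` and a `k`-th derivative of
bounded variation (for `k ≥ 1`).  An absolutely continuous function is differentiable only almost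
everywhere, so the `k`-th derivative is the almost everywhere derivative of `f^(k-1)`, and it is of
bounded variation when it agrees almost everywhere with a function of bounded variation. -/
structure HasBVDerivOfOrder (k : ℕ) (b : ℝ) (f : ℝ → ℂ) : Prop where
  contDiffOn : ContDiffOn ℝ ((k - 1 : ℕ) : ℕ∞) f (Set.Icc 0 b)
  absolutelyContinuous :
    AbsolutelyContinuousOnInterval (iteratedDerivWithin (k - 1) f (Set.Icc 0 b)) 0 b
  boundedVariation : ∃ g : ℝ → ℂ, BoundedVariationOn g (Set.Icc 0 b) ∧
    ∀ᵐ x ∂(MeasureTheory.volume.restrict (Set.Icc 0 b)),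
      HasDerivAt (iteratedDerivWithin (k - 1) f (Set.Icc 0 b)) (g x) x

end

noncomputable section

open MeasureTheory Set

/-! Substitute `x = b/2 - (b/2) cos φ` and expand `f = ∑ a_n T_n` in Chebyshev polynomials on `[0,
b]`. In the nodes `T_n` agrees with `T_{n*}`, where `n* = aliasIndex N n ≤ N`. Hence `P_N f = ∑ a_n
T_{n*}` (`hasSum_ccInterpolant`), and for a weight `w` with moments `M_n = ∫ w T_n` the error is `∑
a_n (M_n - M_{n*})`.

Bounding this sum by absolute values, with only boundedness of the moments, gives `O(N^{-k})`. Two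
facts recover the missing power. Every sum of consecutive `a_n` starting at `p` is `O(p^{-(k+1)})`,
because the recursion between the coefficients of a function and of its derivative telescopes
(`norm_sum_Ico_le_of_telescoping`). The moments satisfy `∑ |M_{n+1} - M_n| < ∞` as soon as `x w(x)`
behaves like `x^γ` for some `γ > 0`, together with two derivatives
(`IsPowerSymbol.summable_norm_chebyshevMoment_sub`). Abel summation over the block `[pN, (p+1)N)`,
on which `n*` is monotone, gives `O((pN)^{-(k+1)})`. The block `p = 0` vanishes, and the sum over
`p` converges.

Both Bessel weights qualify because `α + Re m > -1`; the logarithm costs only an arbitrarily small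
power of `x`. So `O(N^{-(k+1)})` holds in all cases, and the remaining bounds are weaker: `2α + 2 <
1` when `α < -1/2`, and `ln N ≥ ln 2`. -/

/-! ### Summation by parts and sums of consecutive coefficients. -/

theorem norm_sum_range_mul_le_of_norm_sum_le (a c : ℕ → ℂ) (S : ℝ)
    (hS : ∀ l, ‖∑ n ∈ Finset.range l, a n‖ ≤ S) (L : ℕ) :
    ‖∑ n ∈ Finset.range L, a n * c n‖ ≤
      S * (‖c (L - 1)‖ + ∑ n ∈ Finset.range (L - 1), ‖c (n + 1) - c n‖) := by
  have h := Finset.sum_range_by_parts c a L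
  simp only [smul_eq_mul] at h
  have h0 : 0 ≤ S := (norm_nonneg _).trans (hS 0)
  calc ‖∑ n ∈ Finset.range L, a n * c n‖ = ‖∑ n ∈ Finset.range L, c n * a n‖ := by
        simp only [mul_comm]
    _ ≤ ‖c (L - 1) * ∑ n ∈ Finset.range L, a n‖ +
        ‖∑ n ∈ Finset.range (L - 1), (c (n + 1) - c n) * ∑ i ∈ Finset.range (n + 1), a i‖ := by
        rw [h]; exact norm_sub_le _ _
    _ ≤ ‖c (L - 1)‖ * S + ∑ n ∈ Finset.range (L - 1), ‖c (n + 1) - c n‖ * S := by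
        refine add_le_add ?_ ((norm_sum_le _ _).trans (Finset.sum_le_sum fun n _ => ?_))
        · rw [norm_mul]; exact mul_le_mul_of_nonneg_left (hS _) (norm_nonneg _)
        · rw [norm_mul]; exact mul_le_mul_of_nonneg_left (hS _) (norm_nonneg _)
    _ = _ := by rw [← Finset.sum_mul]; ring

/-- With `e n = d n + d (n + 1)` one has `d n - d (n + 2) = e n - e (n + 1)`, so summing `(e n - e
(n + 1)) / (n + 1)` by parts leaves two boundary terms and a sum against the telescoping differences
of `1 / (n + 1)`. A whole range of coefficients thus obeys the same rate as its first term. -/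
theorem norm_sum_Ico_le_of_telescoping (a d : ℕ → ℂ) (c : ℂ) (D : ℝ) (k : ℕ)
    (hrec : ∀ n : ℕ, ((n : ℂ) + 1) * a (n + 1) = c * (d n - d (n + 2)))
    (hd : ∀ n : ℕ, ‖d n‖ ≤ D / ((n : ℝ) + 1) ^ k) (p : ℕ) (hp : 1 ≤ p) (l : ℕ) :
    ‖∑ n ∈ Finset.range l, a (p + n)‖ ≤ 4 * ‖c‖ * D / (p : ℝ) ^ (k + 1) := by
  -- From here on the starting index is `p + 1`, which matches the index `n + 1` in `hrec`.
  obtain ⟨p, rfl⟩ : ∃ r, p = r + 1 := ⟨p - 1, by omega⟩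
  have hD : 0 ≤ D := by simpa using (norm_nonneg _).trans (hd 0)
  set e : ℕ → ℂ := fun n => d n + d (n + 1) with he
  have hne : ∀ n : ℕ, ((n : ℂ) + 1) ≠ 0 := fun n => by exact_mod_cast Nat.succ_ne_zero n
  have key : ∀ l : ℕ, ∑ n ∈ Finset.range l, a (p + 1 + n) =
      c * (e p / ((p : ℂ) + 1) - e (p + l) / (((p + l : ℕ) : ℂ) + 1) -
        ∑ n ∈ Finset.range l, e (p + n + 1) *
          (((1 / (((p + n : ℕ) : ℝ) + 1) - 1 / (((p + n + 1 : ℕ) : ℝ) + 1) : ℝ)) : ℂ)) := by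
    intro l
    induction l with
    | zero => simp
    | succ l ih =>
      rw [Finset.sum_range_succ, Finset.sum_range_succ, ih]
      have h1 := hrec (p + l)
      have h2 : a (p + 1 + l) = c * (d (p + l) - d (p + l + 2)) / (((p + l : ℕ) : ℂ) + 1) := by
        rw [← h1, mul_div_cancel_left₀ _ (hne _)]; congr 1; omega
      rw [h2]
      simp only [he]
      have a1 := hne (p + l)
      have a2 := hne (p + l + 1)
      rw [show p + (l + 1) = p + l + 1 by ring, show p + l + 1 + 1 = p + l + 2 by ring]
      push_cast at a1 a2 ⊢
      field_simp
      ring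
  rw [key]
  have hP : (0 : ℝ) < ((p : ℝ) + 1) ^ k := by positivity
  have hebd : ∀ n, p ≤ n → ‖e n‖ ≤ 2 * D / ((p : ℝ) + 1) ^ k := by
    intro n hn
    have hn' : (p : ℝ) ≤ n := by exact_mod_cast hn
    have b1 : ‖d n‖ ≤ D / ((p : ℝ) + 1) ^ k := (hd n).trans (by gcongr)
    have b2 : ‖d (n + 1)‖ ≤ D / ((p : ℝ) + 1) ^ k := (hd (n + 1)).trans (by
      gcongr; linarith)
    calc ‖e n‖ ≤ ‖d n‖ + ‖d (n + 1)‖ := norm_add_le _ _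
      _ ≤ _ := by rw [two_mul, add_div]; exact add_le_add b1 b2
  set B := 2 * D / ((p : ℝ) + 1) ^ k with hB
  have hBn : 0 ≤ B := by positivity
  have tele : ∀ l : ℕ, ∑ n ∈ Finset.range l,
      (1 / (((p + n : ℕ) : ℝ) + 1) - 1 / (((p + n + 1 : ℕ) : ℝ) + 1)) =
      1 / ((p : ℝ) + 1) - 1 / (((p + l : ℕ) : ℝ) + 1) := fun l => by
    simpa [add_assoc] using
      Finset.sum_range_sub' (fun n : ℕ => 1 / (((p + n : ℕ) : ℝ) + 1)) l
  have nrm : ∀ n : ℕ, ‖((n : ℂ) + 1)‖ = (n : ℝ) + 1 := fun n => by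
    have : ((n : ℂ) + 1) = ((n + 1 : ℕ) : ℂ) := by push_cast; rfl
    rw [this, Complex.norm_natCast]; push_cast; rfl
  have hsum : ‖∑ n ∈ Finset.range l, e (p + n + 1) *
          (((1 / (((p + n : ℕ) : ℝ) + 1) - 1 / (((p + n + 1 : ℕ) : ℝ) + 1) : ℝ)) : ℂ)‖ ≤
      B * (1 / ((p : ℝ) + 1) - 1 / (((p + l : ℕ) : ℝ) + 1)) := by
    rw [← tele, Finset.mul_sum]
    refine (norm_sum_le _ _).trans (Finset.sum_le_sum fun n _ => ?_)
    have hnn : 0 ≤ 1 / (((p + n : ℕ) : ℝ) + 1) - 1 / (((p + n + 1 : ℕ) : ℝ) + 1) := by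
      rw [sub_nonneg]
      exact one_div_le_one_div_of_le (by positivity) (by push_cast; linarith)
    rw [norm_mul, Complex.norm_real, Real.norm_of_nonneg hnn]
    exact mul_le_mul_of_nonneg_right (hebd _ (by omega)) hnn
  have t1 : ‖e p / ((p : ℂ) + 1)‖ ≤ B * (1 / ((p : ℝ) + 1)) := by
    rw [norm_div, nrm, div_eq_mul_one_div]
    exact mul_le_mul_of_nonneg_right (hebd p le_rfl) (by positivity)
  have t2 : ‖e (p + l) / (((p + l : ℕ) : ℂ) + 1)‖ ≤ B * (1 / (((p + l : ℕ) : ℝ) + 1)) := by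
    rw [norm_div, nrm, div_eq_mul_one_div]
    exact mul_le_mul_of_nonneg_right (hebd _ (by omega)) (by positivity)
  rw [norm_mul]
  calc _ ≤ ‖c‖ * (B * (2 * (1 / ((p : ℝ) + 1)))) := by
        gcongr
        refine (norm_sub_le _ _).trans ?_
        have := norm_sub_le (e p / ((p : ℂ) + 1)) (e (p + l) / (((p + l : ℕ) : ℂ) + 1))
        nlinarith
    _ = _ := by rw [hB]; push_cast; rw [pow_succ]; field_simp; ring

/-! ### Aliasing in the nodes and block summation. -/

/-- The index in `0, …, N` of the Chebyshev polynomial which agrees with the `n`-th one in the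
Clenshaw-Curtis points. -/
def aliasIndex (N n : ℕ) : ℕ := if Even (n / N) then n % N else N - n % N

theorem aliasIndex_le (N n : ℕ) (hN : 1 ≤ N) : aliasIndex N n ≤ N := by
  unfold aliasIndex
  have := Nat.mod_lt n hN
  split_ifs <;> omega

theorem aliasIndex_of_lt (N n : ℕ) (h : n < N) : aliasIndex N n = n := by
  simp [aliasIndex, Nat.div_eq_of_lt h, Nat.mod_eq_of_lt h]

theorem aliasIndex_mul_add (N p r : ℕ) (h : r < N) :
    aliasIndex N (p * N + r) = if Even p then r else N - r := by
  have h1 : (p * N + r) / N = p := by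
    rw [mul_comm, Nat.mul_add_div (by omega), Nat.div_eq_of_lt h, add_zero]
  have h2 : (p * N + r) % N = r := by rw [Nat.mul_add_mod', Nat.mod_eq_of_lt h]
  rw [aliasIndex, h1, h2]

/-- At the angles `jπ/N` the index `n` matters only modulo `2N` and up to sign. For odd quotient,
`(2s+1)N + r = 2(s+1)N - (N - r)`. -/
theorem cos_aliasIndex_mul (N n : ℕ) (hN : 1 ≤ N) (j : ℕ) :
    Real.cos (aliasIndex N n * (j * Real.pi / N)) = Real.cos (n * (j * Real.pi / N)) := by
  have hN' : (N : ℝ) ≠ 0 := by positivity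
  obtain ⟨p, r, hr, rfl⟩ : ∃ p r, r < N ∧ n = p * N + r :=
    ⟨n / N, n % N, Nat.mod_lt _ hN, by rw [mul_comm]; exact (Nat.div_add_mod _ _).symm⟩
  rw [aliasIndex_mul_add N p r hr]
  split_ifs with hp
  · obtain ⟨s, rfl⟩ := hp
    have : (((s + s) * N + r : ℕ) : ℝ) * (j * Real.pi / N) =
        r * (j * Real.pi / N) + ((s * j : ℕ) : ℝ) * (2 * Real.pi) := by
      push_cast; field_simp; ring
    rw [this, Real.cos_add_nat_mul_two_pi]
  · obtain ⟨s, rfl⟩ := Nat.not_even_iff_odd.1 hp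
    have : (((2 * s + 1) * N + r : ℕ) : ℝ) * (j * Real.pi / N) =
        (((s + 1) * j : ℕ) : ℝ) * (2 * Real.pi) - ((N - r : ℕ) : ℝ) * (j * Real.pi / N) := by
      rw [Nat.cast_sub hr.le]
      push_cast; field_simp; ring
    rw [this, Real.cos_nat_mul_two_pi_sub]

/-- Summation by parts over blocks of length `N`. -/
theorem norm_sum_range_mul_sub_aliasIndex_le (a M : ℕ → ℂ) (S V B : ℝ) (k N : ℕ)
    (hk : 1 ≤ k) (hN : 1 ≤ N)
    (hS : ∀ p, 1 ≤ p → ∀ l, ‖∑ n ∈ Finset.range l, a (p + n)‖ ≤ S / (p : ℝ) ^ (k + 1))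
    (hB : ∀ n, ‖M n‖ ≤ B) (hM : Summable fun n => ‖M (n + 1) - M n‖)
    (hV : ∑' n, ‖M (n + 1) - M n‖ ≤ V) (Q : ℕ) :
    ‖∑ n ∈ Finset.range (Q * N), a n * (M n - M (aliasIndex N n))‖ ≤
      S * (2 * B + 2 * V) * (∑' p : ℕ, 1 / (p : ℝ) ^ 2) / (N : ℝ) ^ (k + 1) := by
  have hS0 : 0 ≤ S := by simpa using (norm_nonneg _).trans (hS 1 le_rfl 0)
  have hNR : (1 : ℝ) ≤ N := by exact_mod_cast hN
  have hB0 : 0 ≤ B := (norm_nonneg _).trans (hB 0)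
  have hV0 : 0 ≤ V := (tsum_nonneg fun _ => norm_nonneg _).trans hV
  have hvar : ∀ p L : ℕ, ∑ n ∈ Finset.range L, ‖M (p + (n + 1)) - M (p + n)‖ ≤ V := by
    intro p L
    have : ∑ n ∈ Finset.range L, ‖M (p + (n + 1)) - M (p + n)‖ =
        ∑ n ∈ Finset.Ico p (p + L), ‖M (n + 1) - M n‖ := by
      rw [Finset.sum_Ico_eq_sum_range]; simp [add_assoc]
    rw [this]
    exact (hM.sum_le_tsum _ fun _ _ => norm_nonneg _).trans hV
  -- For `p = 0` the right side is `0`, since `1 / 0 = 0`. The block does vanish there, because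
  -- `aliasIndex N` is the identity below `N`.
  have hblock : ∀ p : ℕ, ‖∑ r ∈ Finset.range N,
      a (p * N + r) * (M (p * N + r) - M (aliasIndex N (p * N + r)))‖ ≤
      S * (2 * B + 2 * V) / (N : ℝ) ^ (k + 1) * (1 / (p : ℝ) ^ 2) := by
    intro p
    rcases Nat.eq_zero_or_pos p with rfl | hp
    · rw [Finset.sum_eq_zero]
      · simp
      · intro r hr
        rw [zero_mul, zero_add, aliasIndex_of_lt _ _ (Finset.mem_range.1 hr), sub_self, mul_zero]
    have hpR : (1 : ℝ) ≤ p := by exact_mod_cast hp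
    refine (norm_sum_range_mul_le_of_norm_sum_le (fun r => a (p * N + r))
      (fun r => M (p * N + r) - M (aliasIndex N (p * N + r))) _
      (hS (p * N) (Nat.mul_pos hp hN)) N).trans ?_
    have e1 : ‖M (p * N + (N - 1)) - M (aliasIndex N (p * N + (N - 1)))‖ ≤ 2 * B := by
      refine (norm_sub_le _ _).trans ?_
      linarith [hB (p * N + (N - 1)), hB (aliasIndex N (p * N + (N - 1)))]
    -- Inside a block the aliased index moves by unit steps, upwards for even `p` and downwards for
    -- odd `p`, so the aliased moments have variation at most `V`.
    have halias : ∑ r ∈ Finset.range (N - 1), ‖M (aliasIndex N (p * N + (r + 1))) -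
        M (aliasIndex N (p * N + r))‖ ≤ V := by
      by_cases he : Even p
      · refine le_trans (le_of_eq (Finset.sum_congr rfl fun r hr => ?_)) (hvar 0 (N - 1))
        have := Finset.mem_range.1 hr
        rw [aliasIndex_mul_add N p _ (by omega), aliasIndex_mul_add N p _ (by omega), if_pos he,
          if_pos he, zero_add, zero_add]
      · refine le_trans (le_of_eq ?_) (hvar 1 (N - 1))
        rw [← Finset.sum_range_reflect]
        refine Finset.sum_congr rfl fun r hr => ?_
        have := Finset.mem_range.1 hr
        rw [aliasIndex_mul_add N p _ (by omega), aliasIndex_mul_add N p _ (by omega), if_neg he,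
          if_neg he, norm_sub_rev]
        congr 3 <;> omega
    have e2 : ∑ r ∈ Finset.range (N - 1),
        ‖(M (p * N + (r + 1)) - M (aliasIndex N (p * N + (r + 1)))) -
          (M (p * N + r) - M (aliasIndex N (p * N + r)))‖ ≤ 2 * V := by
      calc _ ≤ ∑ r ∈ Finset.range (N - 1), (‖M (p * N + (r + 1)) - M (p * N + r)‖ +
            ‖M (aliasIndex N (p * N + (r + 1))) - M (aliasIndex N (p * N + r))‖) := by
            refine Finset.sum_le_sum fun r _ => ?_
            rw [sub_sub_sub_comm]
            exact norm_sub_le _ _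
        _ ≤ _ := by rw [Finset.sum_add_distrib]; linarith [hvar (p * N) (N - 1)]
    calc _ ≤ S / ((p * N : ℕ) : ℝ) ^ (k + 1) * (2 * B + 2 * V) := by gcongr
      _ ≤ _ := by
        push_cast
        rw [mul_pow]
        have h2 : (p : ℝ) ^ 2 ≤ (p : ℝ) ^ (k + 1) := pow_le_pow_right₀ hpR (by omega)
        rw [div_mul_eq_mul_div, div_mul_div_comm, mul_one, mul_comm ((p : ℝ) ^ (k + 1))]
        gcongr
  have hsum : ∀ Q : ℕ, ∑ n ∈ Finset.range (Q * N), a n * (M n - M (aliasIndex N n)) =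
      ∑ p ∈ Finset.range Q, ∑ r ∈ Finset.range N,
        a (p * N + r) * (M (p * N + r) - M (aliasIndex N (p * N + r))) := by
    intro Q
    induction Q with
    | zero => simp
    | succ Q ih => rw [Finset.sum_range_succ, ← ih, Nat.succ_mul, Finset.sum_range_add]
  rw [hsum]
  calc _ ≤ ∑ p ∈ Finset.range Q, S * (2 * B + 2 * V) / (N : ℝ) ^ (k + 1) * (1 / (p : ℝ) ^ 2) :=
        (norm_sum_le _ _).trans (Finset.sum_le_sum fun p _ => hblock p)
    _ = S * (2 * B + 2 * V) / (N : ℝ) ^ (k + 1) * ∑ p ∈ Finset.range Q, (1 / (p : ℝ) ^ 2) := by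
        rw [Finset.mul_sum]
    _ ≤ S * (2 * B + 2 * V) / (N : ℝ) ^ (k + 1) * (∑' p : ℕ, 1 / (p : ℝ) ^ 2) := by
        gcongr
        exact (Real.summable_one_div_nat_pow.2 (by norm_num)).sum_le_tsum _
          fun _ _ => by positivity
    _ = _ := by ring

/-! ### Cosine coefficients of functions of bounded variation. -/

theorem BoundedVariationOn.intervalIntegrable_complex {G : ℝ → ℂ} {a b : ℝ} (hab : a ≤ b)
    (hG : BoundedVariationOn G (Icc a b)) : IntervalIntegrable G volume a b := by
  have real : ∀ u : ℝ → ℝ, BoundedVariationOn u (Icc a b) → IntervalIntegrable u volume a b := by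
    intro u hu
    obtain ⟨p, q, hp, hq, rfl⟩ := hu.locallyBoundedVariationOn.exists_monotoneOn_sub_monotoneOn
    rw [← uIcc_of_le hab] at hp hq
    exact hp.intervalIntegrable.sub hq.intervalIntegrable
  have hre := real _ (Complex.reCLM.lipschitz.comp_boundedVariationOn hG)
  have him := real _ (Complex.imCLM.lipschitz.comp_boundedVariationOn hG)
  have toC : ∀ u : ℝ → ℝ, IntervalIntegrable u volume a b →
      IntervalIntegrable (fun x => (u x : ℂ)) volume a b := fun u hu => ⟨hu.1.ofReal, hu.2.ofReal⟩
  have := (toC _ hre).add ((toC _ him).mul_const Complex.I)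
  refine this.congr fun x _ => ?_
  exact Complex.re_add_im (G x)

/-- The points `iπ/(n+1)` are consecutive zeros of `sin ((n+1)φ)`, so the cosine has mean zero
between them. On each piece `G` may therefore be replaced by its difference from the left endpoint
value, which the variation on the piece bounds. -/
theorem BoundedVariationOn.norm_integral_mul_cos_le {G : ℝ → ℂ}
    (hG : BoundedVariationOn G (Icc 0 Real.pi)) (n : ℕ) :
    ‖∫ φ in (0 : ℝ)..Real.pi, G φ * ((Real.cos ((n + 1 : ℕ) * φ) : ℝ) : ℂ)‖ ≤
      Real.pi * (eVariationOn G (Icc 0 Real.pi)).toReal / ((n : ℝ) + 1) := by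
  set s := Icc 0 Real.pi with hs
  have hpi := Real.pi_pos
  have hn : (0 : ℝ) < (n : ℝ) + 1 := by positivity
  have hloc := hG.locallyBoundedVariationOn
  have hint := BoundedVariationOn.intervalIntegrable_complex hpi.le hG
  set p : ℕ → ℝ := fun i => i * (Real.pi / (n + 1)) with hp
  have hp0 : p 0 = 0 := by simp [hp]
  have hpn : p (n + 1) = Real.pi := by simp only [hp]; push_cast; field_simp
  have hpm : ∀ i, p i ≤ p (i + 1) := fun i => by simp only [hp]; gcongr; omega
  have hdiff : ∀ i, p (i + 1) - p i = Real.pi / (n + 1) := fun i => by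
    simp only [hp]; push_cast; ring
  have hps : ∀ i, i ≤ n + 1 → p i ∈ s := by
    intro i hi
    refine ⟨by simp only [hp]; positivity, ?_⟩
    rw [← hpn]; simp only [hp]; gcongr
  set v := variationOnFromTo G s 0 with hv
  have h0s : (0 : ℝ) ∈ s := ⟨le_rfl, hpi.le⟩
  have hcos : Continuous fun φ : ℝ => ((Real.cos ((n + 1 : ℕ) * φ) : ℝ) : ℂ) := by fun_prop
  have hsubset : ∀ i, i < n + 1 → uIcc (p i) (p (i + 1)) ⊆ uIcc 0 Real.pi := by
    intro i hi
    rw [uIcc_of_le (hpm i), uIcc_of_le hpi.le]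
    exact Icc_subset_Icc (hps i hi.le).1 (hps (i + 1) hi).2
  have hsplit := intervalIntegral.sum_integral_adjacent_intervals (n := n + 1) (a := p)
    (μ := volume) (f := fun φ => G φ * ((Real.cos ((n + 1 : ℕ) * φ) : ℝ) : ℂ))
    (fun i hi => (hint.mul_continuousOn hcos.continuousOn).mono_set (hsubset i hi))
  rw [hp0, hpn] at hsplit
  rw [← hsplit]
  have hpiece : ∀ i ∈ Finset.range (n + 1),
      ‖∫ φ in p i..p (i + 1), G φ * ((Real.cos ((n + 1 : ℕ) * φ) : ℝ) : ℂ)‖ ≤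
      (v (p (i + 1)) - v (p i)) * (Real.pi / (n + 1)) := by
    intro i hi
    have hi' := Finset.mem_range.1 hi
    have hz : ∫ φ in p i..p (i + 1), G (p i) * ((Real.cos ((n + 1 : ℕ) * φ) : ℝ) : ℂ) = 0 := by
      rw [intervalIntegral.integral_const_mul, intervalIntegral.integral_ofReal,
        intervalIntegral.integral_comp_mul_left (fun x => Real.cos x) (by positivity),
        integral_cos]
      have e : ∀ j : ℕ, Real.sin (((n + 1 : ℕ) : ℝ) * p j) = 0 := fun j => by
        rw [show ((n + 1 : ℕ) : ℝ) * p j = j * Real.pi by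
          simp only [hp]; push_cast; field_simp]
        exact Real.sin_nat_mul_pi j
      rw [e, e]; simp
    rw [← sub_zero (∫ φ in p i..p (i + 1), _), ← hz, ← intervalIntegral.integral_sub]
    · rw [← hdiff i, ← abs_of_nonneg (sub_nonneg.2 (hpm i))]
      refine intervalIntegral.norm_integral_le_of_norm_le_const fun x hx => ?_
      rw [uIoc_of_le (hpm i)] at hx
      have hxs : x ∈ s := ⟨(hps i hi'.le).1.trans hx.1.le, hx.2.trans (hps (i + 1) hi').2⟩
      rw [← sub_mul, norm_mul, Complex.norm_real]
      calc _ ≤ ‖G x - G (p i)‖ * 1 := by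
            gcongr; exact Real.abs_cos_le_one _
        _ = dist (G (p i)) (G x) := by rw [mul_one, dist_comm, dist_eq_norm]
        _ ≤ variationOnFromTo G s (p i) x := by
            rw [variationOnFromTo.eq_of_le G s hx.1.le, dist_edist]
            exact ENNReal.toReal_mono (hloc _ _ (hps i hi'.le) hxs)
              (eVariationOn.edist_le G ⟨hps i hi'.le, le_rfl, hx.1.le⟩ ⟨hxs, hx.1.le, le_rfl⟩)
        _ = v x - v (p i) := by
            rw [hv, ← variationOnFromTo.add hloc h0s (hps i hi'.le) hxs, add_sub_cancel_left]
        _ ≤ v (p (i + 1)) - v (p i) := by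
            gcongr
            exact variationOnFromTo.monotoneOn hloc h0s hxs (hps (i + 1) hi') hx.2
    · exact (hint.mul_continuousOn hcos.continuousOn).mono_set (hsubset i hi')
    · exact (continuous_const.mul hcos).intervalIntegrable _ _
  refine (norm_sum_le _ _).trans ((Finset.sum_le_sum hpiece).trans ?_)
  rw [← Finset.sum_mul, Finset.sum_range_sub (fun i => v (p i)), hp0, hpn]
  have hv1 : v Real.pi - v 0 ≤ (eVariationOn G s).toReal := by
    rw [hv, variationOnFromTo.self, sub_zero]
    exact (le_abs_self _).trans (variationOnFromTo.abs_le_eVariationOn hG)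
  calc _ ≤ (eVariationOn G s).toReal * (Real.pi / (n + 1)) := by gcongr
    _ = _ := by ring

/-! ### The substitution by the angle. -/

/-- The point of `[0, b]` with angle `φ`, measured from the end `0`. -/
def angleNode (b φ : ℝ) : ℝ := b / 2 - b / 2 * Real.cos φ

theorem continuous_angleNode (b : ℝ) : Continuous (angleNode b) := by
  unfold angleNode; fun_prop

theorem hasDerivAt_angleNode (b φ : ℝ) :
    HasDerivAt (angleNode b) (b / 2 * Real.sin φ) φ := by
  have := ((Real.hasDerivAt_cos φ).const_mul (b / 2)).const_sub (b / 2)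
  exact this.congr_deriv (by ring)

theorem angleNode_mem (b : ℝ) (hb : 0 < b) (φ : ℝ) : angleNode b φ ∈ Icc 0 b := by
  unfold angleNode
  constructor <;> nlinarith [Real.cos_le_one φ, Real.neg_one_le_cos φ]

theorem lipschitzWith_angleNode (b : ℝ) (hb : 0 < b) :
    LipschitzWith (b / 2).toNNReal (angleNode b) := by
  refine lipschitzWith_of_nnnorm_deriv_le (fun φ => (hasDerivAt_angleNode b φ).differentiableAt)
    fun φ => ?_
  rw [(hasDerivAt_angleNode b φ).deriv, ← NNReal.coe_le_coe, coe_nnnorm,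
    Real.coe_toNNReal _ (by positivity), norm_mul, Real.norm_of_nonneg (by positivity : 0 ≤ b / 2)]
  exact mul_le_of_le_one_right (by positivity) (Real.abs_sin_le_one φ)

theorem monotoneOn_angleNode (b : ℝ) (hb : 0 < b) :
    MonotoneOn (angleNode b) (Icc 0 Real.pi) := by
  intro x hx y hy hxy
  have := Real.antitoneOn_cos hx hy hxy
  unfold angleNode
  nlinarith

theorem angleNode_arccos (b : ℝ) (hb : 0 < b) (x : ℝ) (hx : x ∈ Icc 0 b) :
    angleNode b (Real.arccos (1 - 2 * x / b)) = x := by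
  have h1 : x / b ≤ 1 := (div_le_one hb).2 hx.2
  have h2 : 0 ≤ x / b := div_nonneg hx.1 hb.le
  rw [angleNode, Real.cos_arccos]
  · field_simp; ring
  · rw [mul_div_assoc]; linarith
  · rw [mul_div_assoc]; linarith

theorem arccos_angleNode (b : ℝ) (hb : 0 < b) (φ : ℝ) (hφ : φ ∈ Icc 0 Real.pi) :
    Real.arccos (1 - 2 * angleNode b φ / b) = φ := by
  rw [show 1 - 2 * angleNode b φ / b = Real.cos φ by unfold angleNode; field_simp; ring]
  exact Real.arccos_cos hφ.1 hφ.2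

/-- Null sets pull back to null sets under `angleNode`. -/
theorem ae_comp_angleNode (b : ℝ) (hb : 0 < b) {P : ℝ → Prop}
    (hP : ∀ᵐ x ∂volume.restrict (Icc 0 b), P x) :
    ∀ᵐ φ, φ ∈ Icc 0 Real.pi → P (angleNode b φ) := by
  rw [ae_restrict_iff' measurableSet_Icc] at hP
  -- The exceptional angles lie in the image of a null set under the inverse map, which is
  -- differentiable only for `0 < x < b`; the two end angles are added separately.
  set Z : Set ℝ := {x | x ∈ Ioo 0 b ∧ ¬ P x} with hZ
  have hZ0 : volume Z = 0 := by
    refine measure_mono_null ?_ (ae_iff.1 hP)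
    rintro x ⟨hx, hx'⟩
    simp only [mem_ofPred_eq, Classical.not_imp]
    exact ⟨Ioo_subset_Icc_self hx, hx'⟩
  have himg : volume ((fun x => Real.arccos (1 - 2 * x / b)) '' Z) = 0 := by
    refine addHaar_image_eq_zero_of_differentiableOn_of_addHaar_eq_zero volume ?_ hZ0
    rintro x ⟨hx, -⟩
    refine DifferentiableAt.differentiableWithinAt ?_
    have h1 : x / b < 1 := (div_lt_one hb).2 hx.2
    have h2 : 0 < x / b := div_pos hx.1 hb
    refine DifferentiableAt.comp (g := Real.arccos) (f := fun x => 1 - 2 * x / b) x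
      (Real.differentiableAt_arccos.2 ⟨?_, ?_⟩) (by fun_prop)
    · intro h; rw [mul_div_assoc] at h; linarith
    · intro h; rw [mul_div_assoc] at h; linarith
  have hnull : volume ((fun x => Real.arccos (1 - 2 * x / b)) '' Z ∪ {0, Real.pi}) = 0 :=
    measure_union_null himg ((Set.toFinite _).measure_zero _)
  rw [ae_iff]
  refine measure_mono_null ?_ hnull
  intro φ hφ
  simp only [mem_ofPred_eq, Classical.not_imp] at hφ
  obtain ⟨hφ, hnp⟩ := hφ
  by_cases h0 : φ = 0
  · right; left; exact h0
  by_cases h1 : φ = Real.pi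
  · right; right; exact h1
  left
  refine ⟨angleNode b φ, ⟨?_, hnp⟩, arccos_angleNode b hb φ hφ⟩
  have hc1 : Real.cos φ < 1 := by
    rw [← Real.cos_zero]
    exact Real.strictAntiOn_cos ⟨le_rfl, Real.pi_pos.le⟩ hφ (lt_of_le_of_ne hφ.1 (Ne.symm h0))
  have hc2 : -1 < Real.cos φ := by
    rw [← Real.cos_pi]
    exact Real.strictAntiOn_cos hφ ⟨Real.pi_pos.le, le_rfl⟩ (lt_of_le_of_ne hφ.2 h1)
  unfold angleNode
  constructor <;> nlinarith

/-- The fundamental theorem of calculus for an absolutely continuous function with bounded almost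
everywhere derivative. -/
theorem AbsolutelyContinuousOnInterval.integral_eq_sub_of_ae_hasDerivAt {u v : ℝ → ℂ} {a b : ℝ}
    (hab : a ≤ b) (hu : AbsolutelyContinuousOnInterval u a b)
    (hd : ∀ᵐ x, x ∈ Icc a b → HasDerivAt u (v x) x) (M : ℝ) (hM : ∀ x ∈ Icc a b, ‖v x‖ ≤ M) :
    (∀ x ∈ Icc a b, ∫ t in a..x, v t = u x - u a) ∧ LipschitzOnWith M.toNNReal u (Icc a b) := by
  have hmeas : AEStronglyMeasurable v (volume.restrict (Icc a b)) := by
    refine ((measurable_deriv u).aestronglyMeasurable).congr ?_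
    filter_upwards [(ae_restrict_iff' measurableSet_Icc).2 hd] with x hx using hx.deriv
  have hon : IntegrableOn v (Icc a b) :=
    Integrable.of_bound hmeas M
      ((ae_restrict_iff' measurableSet_Icc).2 (Filter.Eventually.of_forall hM))
  have hint : IntervalIntegrable v volume a b := by
    rw [intervalIntegrable_iff_integrableOn_Icc_of_le hab]; exact hon
  have hsub : ∀ x ∈ Icc a b, IntervalIntegrable v volume a x := fun x hx =>
    hint.mono_set (by rw [uIcc_of_le hab, uIcc_of_le hx.1]; exact Icc_subset_Icc_right hx.2)
  have hlip : LipschitzOnWith M.toNNReal (fun x => ∫ t in a..x, v t) (uIcc a b) := by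
    rw [uIcc_of_le hab]
    refine LipschitzOnWith.of_dist_le_mul fun x hx y hy => ?_
    rw [dist_eq_norm, intervalIntegral.integral_interval_sub_left (hsub x hx) (hsub y hy)]
    have h0 : 0 ≤ M := (norm_nonneg _).trans (hM x hx)
    rw [Real.coe_toNNReal _ h0, Real.dist_eq]
    refine intervalIntegral.norm_integral_le_of_norm_le_const fun t ht => hM t ?_
    have := uIoc_subset_uIcc ht
    exact ⟨(le_min hy.1 hx.1).trans this.1, this.2.trans (max_le hy.2 hx.2)⟩
  -- The difference of `u` and the integral of `v` is absolutely continuous with derivative zero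
  -- almost everywhere, hence constant.
  have hac := hu.fun_sub hlip.absolutelyContinuousOnInterval
  obtain ⟨C, hC⟩ := hac.const_of_ae_hasDerivAt_zero (by
    filter_upwards [hd, hint.ae_hasDerivAt_integral] with x hx1 hx2 hx
    have := (hx1 (by rwa [uIcc_of_le hab] at hx)).sub (hx2 hx a left_mem_uIcc)
    rwa [sub_self] at this)
  have hft : ∀ x ∈ Icc a b, ∫ t in a..x, v t = u x - u a := by
    intro x hx
    have h1 := hC x (by rwa [uIcc_of_le hab])
    have h2 := hC a left_mem_uIcc
    simp only [intervalIntegral.integral_same, sub_zero] at h2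
    rw [h2, ← h1]; ring
  refine ⟨hft, fun x hx y hy => ?_⟩
  rw [uIcc_of_le hab] at hlip
  have := hlip hx hy
  dsimp only at this
  rwa [hft x hx, hft y hy, edist_sub_right] at this

/-! ### Recursion between the coefficients of a function and of its derivative. -/

/-- `∫₀^π h(x(φ)) cos(nφ) dφ`, a Chebyshev coefficient of `h` on `[0, b]` up to normalisation. -/
def cosCoeff (b : ℝ) (h : ℝ → ℂ) (n : ℕ) : ℂ :=
  ∫ φ in (0 : ℝ)..Real.pi, h (angleNode b φ) * ((Real.cos (n * φ) : ℝ) : ℂ)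

/-- The function `sin ((n+1)φ) h(x(φ))` vanishes at `0` and `π`, so its derivative integrates to
zero. The term with `h'` carries `(b/2) sin φ sin ((n+1)φ) = (b/4) (cos (nφ) - cos ((n+2)φ))`. The
Lipschitz bound provides the absolute continuity that an almost everywhere derivative requires. -/
theorem cosCoeff_succ (b : ℝ) (hb : 0 < b) (h h' : ℝ → ℂ) (K : NNReal)
    (hL : LipschitzOnWith K h (Icc 0 b))
    (hd : ∀ᵐ x ∂volume.restrict (Icc 0 b), HasDerivAt h (h' x) x)
    (M : ℝ) (hM : ∀ x ∈ Icc 0 b, ‖h' x‖ ≤ M)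
    (hi : IntervalIntegrable (fun φ => h' (angleNode b φ)) volume 0 Real.pi) (n : ℕ) :
    ((n : ℂ) + 1) * cosCoeff b h (n + 1) =
      (-(b / 4) : ℂ) * (cosCoeff b h' n - cosCoeff b h' (n + 2)) := by
  have hpi := Real.pi_pos
  have hmaps : MapsTo (angleNode b) univ (Icc 0 b) := fun φ _ => angleNode_mem b hb φ
  have hLc : LipschitzWith (K * (b / 2).toNNReal) (fun φ => h (angleNode b φ)) := by
    rw [← lipschitzOnWith_univ]
    exact hL.comp (lipschitzWith_angleNode b hb).lipschitzOnWith hmaps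
  have hcont : Continuous fun φ => h (angleNode b φ) := hLc.continuous
  have hsinAC : AbsolutelyContinuousOnInterval (fun φ : ℝ => Real.sin ((n + 1) * φ)) 0 Real.pi :=
    ContDiffOn.absolutelyContinuousOnInterval
      (Real.contDiff_sin.comp (contDiff_const.mul contDiff_id)).contDiffOn
  have hAC := hsinAC.fun_smul (hLc.lipschitzOnWith (s := uIcc 0 Real.pi)).absolutelyContinuousOnInterval
  obtain ⟨C, hC⟩ := isCompact_Icc.exists_bound_of_continuousOn (hcont.continuousOn (s := Icc 0 Real.pi))
  have hder := AbsolutelyContinuousOnInterval.integral_eq_sub_of_ae_hasDerivAt hpi.le hAC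
    (v := fun φ => Real.sin ((n + 1) * φ) • ((b / 2 * Real.sin φ) • h' (angleNode b φ)) +
      (Real.cos ((n + 1) * φ) * (n + 1)) • h (angleNode b φ)) ?_
    (1 * (b / 2 * 1 * M) + 1 * (n + 1) * C) ?_
  · have h1 := hder.1 Real.pi ⟨hpi.le, le_rfl⟩
    have e1 : Real.sin (((n : ℝ) + 1) * Real.pi) = 0 := by exact_mod_cast Real.sin_nat_mul_pi (n + 1)
    simp only [e1, mul_zero, Real.sin_zero, zero_smul, sub_zero] at h1
    have hcn : ∀ m : ℕ, IntervalIntegrable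
        (fun φ => h' (angleNode b φ) * ((Real.cos (m * φ) : ℝ) : ℂ)) volume 0 Real.pi :=
      fun m => hi.mul_continuousOn (by fun_prop)
    have hch : IntervalIntegrable (fun φ => ((n : ℂ) + 1) *
        (h (angleNode b φ) * ((Real.cos ((n + 1 : ℕ) * φ) : ℝ) : ℂ))) volume 0 Real.pi :=
      Continuous.intervalIntegrable (continuous_const.mul (hcont.mul (by fun_prop))) _ _
    have h2 : ∀ φ : ℝ, Real.sin ((n + 1) * φ) • ((b / 2 * Real.sin φ) • h' (angleNode b φ)) +
      (Real.cos ((n + 1) * φ) * (n + 1)) • h (angleNode b φ) =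
        (b / 4 : ℂ) * (h' (angleNode b φ) * ((Real.cos (n * φ) : ℝ) : ℂ) -
          h' (angleNode b φ) * ((Real.cos ((n + 2 : ℕ) * φ) : ℝ) : ℂ)) +
        ((n : ℂ) + 1) * (h (angleNode b φ) * ((Real.cos ((n + 1 : ℕ) * φ) : ℝ) : ℂ)) := by
      intro φ
      have e2 : Real.cos (n * φ) = Real.cos ((n + 1) * φ) * Real.cos φ +
          Real.sin ((n + 1) * φ) * Real.sin φ := by rw [← Real.cos_sub]; ring_nf
      have e3 : Real.cos ((n + 2 : ℕ) * φ) = Real.cos ((n + 1) * φ) * Real.cos φ -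
          Real.sin ((n + 1) * φ) * Real.sin φ := by rw [← Real.cos_add]; push_cast; ring_nf
      rw [e2, e3]
      simp only [Complex.real_smul]
      push_cast
      ring
    simp only [h2] at h1
    rw [intervalIntegral.integral_add (((hcn n).sub (hcn (n + 2))).const_mul _) hch,
      intervalIntegral.integral_const_mul, intervalIntegral.integral_const_mul,
      intervalIntegral.integral_sub (hcn n) (hcn (n + 2))] at h1
    unfold cosCoeff
    linear_combination h1
  · filter_upwards [ae_comp_angleNode b hb hd] with φ hφ hmem
    have h3 := HasDerivAt.scomp (𝕜 := ℝ) φ (hφ hmem) (hasDerivAt_angleNode b φ)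
    have h4 : HasDerivAt (fun φ : ℝ => Real.sin ((n + 1) * φ))
        (Real.cos ((n + 1) * φ) * (n + 1)) φ := by
      simpa using ((hasDerivAt_id φ).const_mul ((n : ℝ) + 1)).sin
    exact h4.smul h3
  · intro φ hφ
    have hb' := hM _ (angleNode_mem b hb φ)
    have hC' := hC φ hφ
    have s1 := Real.abs_sin_le_one ((n + 1) * φ)
    have s2 := Real.abs_sin_le_one φ
    have s3 := Real.abs_cos_le_one ((n + 1) * φ)
    refine (norm_add_le _ _).trans ?_
    simp only [norm_smul, norm_mul, Real.norm_eq_abs]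
    rw [abs_of_pos (by positivity : 0 < b / 2), abs_of_pos (by positivity : (0 : ℝ) < (n : ℝ) + 1)]
    gcongr

theorem BoundedVariationOn.norm_cosCoeff_le (b : ℝ) (hb : 0 < b) (g : ℝ → ℂ)
    (hg : BoundedVariationOn g (Icc 0 b)) :
    IntervalIntegrable (fun φ => g (angleNode b φ)) volume 0 Real.pi ∧
      ∃ C, ∀ n, ‖cosCoeff b g n‖ ≤ C / ((n : ℝ) + 1) ^ 1 := by
  have hG : BoundedVariationOn (g ∘ angleNode b) (Icc 0 Real.pi) :=
    ne_top_of_le_ne_top hg (eVariationOn.comp_le_of_monotoneOn g _ (monotoneOn_angleNode b hb)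
      fun φ _ => angleNode_mem b hb φ)
  refine ⟨BoundedVariationOn.intervalIntegrable_complex Real.pi_pos.le hG,
    -- The first summand covers `n = 0`; the factor `2` absorbs the index shift through `n + 2 ≤ 2
    -- (n + 1)`.
    ‖cosCoeff b g 0‖ + 2 * (Real.pi * (eVariationOn (g ∘ angleNode b) (Icc 0 Real.pi)).toReal),
    fun n => ?_⟩
  have hV : 0 ≤ Real.pi * (eVariationOn (g ∘ angleNode b) (Icc 0 Real.pi)).toReal := by positivity
  rw [pow_one]
  rcases n with _ | n
  · simpa using hV
  · refine (BoundedVariationOn.norm_integral_mul_cos_le hG n).trans ?_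
    rw [div_le_div_iff₀ (by positivity) (by positivity)]
    push_cast
    have := norm_nonneg (cosCoeff b g 0)
    nlinarith [mul_nonneg this (Nat.cast_nonneg (α := ℝ) n), mul_nonneg hV (Nat.cast_nonneg (α := ℝ) n)]

/-! ### Chebyshev series of `f` and of its interpolant. -/

/-- The Chebyshev coefficients of `f` on `[0, b]`, the polynomials being numbered from the end
`0`. -/
def chebyshevCoeff (b : ℝ) (f : ℝ → ℂ) (n : ℕ) : ℂ :=
  (if n = 0 then 1 else 2) / (Real.pi : ℂ) * cosCoeff b f n

/-- The Chebyshev polynomial `cos (n θ)` on `[0, b]`, where `x = b / 2 - b / 2 * cos θ`. -/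
def shiftedChebyshev (b : ℝ) (n : ℕ) (x : ℝ) : ℝ := Real.cos (n * Real.arccos (1 - 2 * x / b))

theorem continuous_shiftedChebyshev (b : ℝ) (n : ℕ) : Continuous (shiftedChebyshev b n) := by
  unfold shiftedChebyshev
  exact Real.continuous_cos.comp (continuous_const.mul (Real.continuous_arccos.comp (by fun_prop)))

theorem norm_shiftedChebyshev_le (b : ℝ) (n : ℕ) (x : ℝ) :
    ‖(shiftedChebyshev b n x : ℂ)‖ ≤ 1 := by
  rw [Complex.norm_real]; exact Real.abs_cos_le_one _

/-- This is the Fourier series of the even `2π`-periodic function `f(x(φ))`, with the terms of index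
`n` and `-n` combined. Pairing counts the index `0` twice, so it is subtracted once. -/
theorem hasSum_cosCoeff (b : ℝ) (hb : 0 < b) (f : ℝ → ℂ) (hf : ContinuousOn f (Icc 0 b))
    (hs : Summable fun n => ‖cosCoeff b f n‖) (θ : ℝ) :
    HasSum (fun n => chebyshevCoeff b f n * ((Real.cos (n * θ) : ℝ) : ℂ))
      (f (angleNode b θ)) := by
  have : Fact (0 < 2 * Real.pi) := ⟨by positivity⟩
  have hpi : (Real.pi : ℂ) ≠ 0 := by exact_mod_cast Real.pi_ne_zero
  have hper : Function.Periodic (fun φ => f (angleNode b φ)) (2 * Real.pi) := fun φ => by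
    simp [angleNode]
  have hcont : Continuous fun φ => f (angleNode b φ) :=
    hf.comp_continuous (continuous_angleNode b) (angleNode_mem b hb)
  let F : C(AddCircle (2 * Real.pi), ℂ) := ⟨hper.lift, continuous_quot_lift _ hcont⟩
  have hF : ∀ φ : ℝ, F (φ : AddCircle (2 * Real.pi)) = f (angleNode b φ) := fun φ => rfl
  have hcoeff : ∀ n : ℤ, fourierCoeff F n = 1 / (Real.pi : ℂ) * cosCoeff b f n.natAbs := by
    intro n
    rw [fourierCoeff_eq_intervalIntegral _ n (-Real.pi)]
    have e1 : ∀ φ : ℝ, fourier (-n) (φ : AddCircle (2 * Real.pi)) • F φ =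
        f (angleNode b φ) * Complex.exp (-(n * φ * Complex.I)) := by
      intro φ
      rw [fourier_coe_apply, hF, smul_eq_mul, mul_comm]
      congr 2
      push_cast
      field_simp
    simp only [e1]
    rw [show -Real.pi + 2 * Real.pi = Real.pi by ring]
    have hc : Continuous fun φ : ℝ => f (angleNode b φ) * Complex.exp (-(n * φ * Complex.I)) :=
      hcont.mul (by fun_prop)
    have hc' : Continuous fun φ : ℝ => f (angleNode b φ) * Complex.exp (n * φ * Complex.I) :=
      hcont.mul (by fun_prop)
    rw [← intervalIntegral.integral_add_adjacent_intervals (b := (0 : ℝ))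
      (hc.intervalIntegrable _ _) (hc.intervalIntegrable _ _)]
    have e2 : ∫ φ in (-Real.pi)..0, f (angleNode b φ) * Complex.exp (-(n * φ * Complex.I)) =
        ∫ φ in (0 : ℝ)..Real.pi, f (angleNode b φ) * Complex.exp (n * φ * Complex.I) := by
      have := intervalIntegral.integral_comp_neg (a := 0) (b := Real.pi)
        (fun φ : ℝ => f (angleNode b φ) * Complex.exp (-(n * φ * Complex.I)))
      rw [neg_zero] at this
      rw [← this]
      refine intervalIntegral.integral_congr fun φ _ => ?_
      simp [angleNode]
    rw [e2, ← intervalIntegral.integral_add (hc'.intervalIntegrable _ _)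
      (hc.intervalIntegrable _ _)]
    have e3 : ∀ φ : ℝ, f (angleNode b φ) * Complex.exp (n * φ * Complex.I) +
        f (angleNode b φ) * Complex.exp (-(n * φ * Complex.I)) =
        2 * (f (angleNode b φ) * ((Real.cos (n.natAbs * φ) : ℝ) : ℂ)) := by
      intro φ
      have h1 : Real.cos ((n.natAbs : ℝ) * φ) = Real.cos (n * φ) := by
        rcases Int.natAbs_eq n with h | h
        · nth_rw 2 [h]; simp
        · nth_rw 2 [h]; simp
      rw [h1, Complex.ofReal_cos, Complex.cos]
      push_cast
      rw [neg_mul]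
      ring
    simp only [e3]
    rw [intervalIntegral.integral_const_mul]
    unfold cosCoeff
    rw [Complex.real_smul]
    push_cast
    field_simp
  have hsum : Summable (fourierCoeff F) := by
    refine Summable.of_norm ?_
    have h1 : Summable fun n : ℕ => ‖1 / (Real.pi : ℂ)‖ * ‖cosCoeff b f n‖ := hs.mul_left _
    refine Summable.of_nat_of_neg ?_ ?_
    · simpa [hcoeff] using h1
    · simpa [hcoeff] using h1
  have h := (has_pointwise_sum_fourier_series_of_summable hsum (θ : AddCircle (2 * Real.pi))).nat_add_neg
  have h0 : HasSum (fun n : ℕ => if n = 0 then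
      fourierCoeff F 0 • fourier 0 (θ : AddCircle (2 * Real.pi)) else 0)
      (fourierCoeff F 0 • fourier 0 (θ : AddCircle (2 * Real.pi))) := hasSum_ite_eq 0 _
  have h2 := h.sub h0
  rw [hF, add_sub_cancel_right] at h2
  have hterm : (fun n : ℕ => chebyshevCoeff b f n * ((Real.cos (n * θ) : ℝ) : ℂ)) = fun n : ℕ =>
      fourierCoeff F n • fourier n (θ : AddCircle (2 * Real.pi)) +
        fourierCoeff F (-n) • fourier (-n) (θ : AddCircle (2 * Real.pi)) -
      if n = 0 then fourierCoeff F 0 • fourier 0 (θ : AddCircle (2 * Real.pi)) else 0 := by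
    funext n
    rcases Nat.eq_zero_or_pos n with rfl | hn
    · simp [chebyshevCoeff, hcoeff]
    · have e1 : ∀ m : ℤ, fourier m (θ : AddCircle (2 * Real.pi)) =
          Complex.exp (m * θ * Complex.I) := fun m => by
        rw [fourier_coe_apply]
        congr 1
        push_cast
        field_simp
      rw [if_neg hn.ne', sub_zero, e1, e1, hcoeff, hcoeff, chebyshevCoeff, if_neg hn.ne',
        Complex.ofReal_cos, Complex.cos]
      simp only [Int.natAbs_neg, Int.natAbs_natCast, smul_eq_mul]
      push_cast
      ring
  rw [hterm]
  exact h2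

/-- Interpolation is a finite linear combination of node values, so it acts on the series term by
term. The aliased Chebyshev polynomial has degree at most `N` and the same node values as the `n`-th
one, so it is its interpolant. -/
theorem hasSum_ccInterpolant (b : ℝ) (hb : 0 < b) (N : ℕ) (hN : 1 ≤ N) (f : ℝ → ℂ) (a : ℕ → ℂ)
    (hf : ∀ x ∈ Icc 0 b, HasSum (fun n => a n * (shiftedChebyshev b n x : ℂ)) (f x))
    (x : ℝ) (hx : x ∈ Icc 0 b) :
    HasSum (fun n => a n * (shiftedChebyshev b (aliasIndex N n) x : ℂ))
      ((ccInterpolant b N f).eval (x : ℂ)) := by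
  have hN0 : (0 : ℝ) < N := by exact_mod_cast hN
  -- The nodes are numbered from the end `b`, the angles from the end `0`; hence `N - j`.
  have hnode : ∀ j ≤ N, clenshawCurtisPoint b N j =
      angleNode b (((N - j : ℕ) : ℝ) * Real.pi / N) := by
    intro j hj
    unfold clenshawCurtisPoint angleNode
    rw [Nat.cast_sub hj, show ((N : ℝ) - j) * Real.pi / N = Real.pi - j * Real.pi / N by
      field_simp, Real.cos_pi_sub]
    ring
  have hang : ∀ j : ℕ, j ≤ N → (j : ℝ) * Real.pi / N ∈ Icc 0 Real.pi := by
    intro j hj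
    refine ⟨by positivity, ?_⟩
    rw [div_le_iff₀ hN0, mul_comm]
    have : (j : ℝ) ≤ N := by exact_mod_cast hj
    gcongr
  have hcheb : ∀ n j, j ≤ N → shiftedChebyshev b n (clenshawCurtisPoint b N j) =
      Real.cos (n * (((N - j : ℕ) : ℝ) * Real.pi / N)) := by
    intro n j hj
    rw [hnode j hj, shiftedChebyshev, arccos_angleNode b hb _ (hang _ (by omega))]
  have hmem : ∀ j ≤ N, clenshawCurtisPoint b N j ∈ Icc 0 b := fun j hj => by
    rw [hnode j hj]; exact angleNode_mem b hb _
  set v : ℕ → ℂ := fun j => (clenshawCurtisPoint b N j : ℂ) with hv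
  have hinj : InjOn v (Finset.range (N + 1)) := by
    intro i hi j hj hij
    have hi' : i ≤ N := Nat.lt_succ_iff.1 (Finset.mem_range.1 hi)
    have hj' : j ≤ N := Nat.lt_succ_iff.1 (Finset.mem_range.1 hj)
    have h1 : clenshawCurtisPoint b N i = clenshawCurtisPoint b N j := Complex.ofReal_injective hij
    unfold clenshawCurtisPoint at h1
    have h2 : Real.cos (i * Real.pi / N) = Real.cos (j * Real.pi / N) := by
      have : b / 2 ≠ 0 := by positivity
      exact mul_left_cancel₀ this (by linarith)
    have h3 := Real.injOn_cos (hang i hi') (hang j hj') h2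
    have hpi := Real.pi_ne_zero
    field_simp at h3
    exact_mod_cast h3
  let T : ℕ → Polynomial ℂ := fun n =>
    (Polynomial.Chebyshev.T ℂ n).comp (1 - Polynomial.C (2 / (b : ℂ)) * Polynomial.X)
  have hT : ∀ n, ∀ y ∈ Icc 0 b, (T n).eval (y : ℂ) = (shiftedChebyshev b n y : ℂ) := by
    intro n y hy
    have h1 : 1 - 2 / (b : ℂ) * y = Complex.cos ((Real.arccos (1 - 2 * y / b) : ℝ) : ℂ) := by
      have h2 := angleNode_arccos b hb y hy
      unfold angleNode at h2
      rw [← Complex.ofReal_cos, show Real.cos (Real.arccos (1 - 2 * y / b)) = 1 - 2 * y / b by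
        field_simp at h2 ⊢; linarith]
      push_cast; ring
    simp only [T, Polynomial.eval_comp, Polynomial.eval_sub, Polynomial.eval_one,
      Polynomial.eval_mul, Polynomial.eval_C, Polynomial.eval_X, h1,
      Polynomial.Chebyshev.T_complex_cos, shiftedChebyshev]
    push_cast
    rfl
  have hdeg : ∀ n ≤ N, (T n).degree < (Finset.range (N + 1)).card := by
    intro n hn
    rw [Finset.card_range]
    refine Polynomial.degree_le_natDegree.trans_lt ?_
    have h1 : (T n).natDegree ≤ n := by
      refine Polynomial.natDegree_comp_le.trans ?_
      have h2 : (1 - Polynomial.C (2 / (b : ℂ)) * Polynomial.X).natDegree ≤ 1 := by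
        compute_degree
      rw [Polynomial.Chebyshev.natDegree_T]
      simpa using Nat.mul_le_mul_left n h2
    exact_mod_cast Nat.lt_succ_of_le (h1.trans hn)
  have hrepr : ∀ n, ((shiftedChebyshev b (aliasIndex N n) x : ℝ) : ℂ) =
      ∑ j ∈ Finset.range (N + 1), (shiftedChebyshev b n (clenshawCurtisPoint b N j) : ℂ) *
        (Lagrange.basis (Finset.range (N + 1)) v j).eval (x : ℂ) := by
    intro n
    rw [← hT _ x hx, Lagrange.eq_interpolate hinj (hdeg _ (aliasIndex_le N n hN)),
      Lagrange.interpolate_apply, Polynomial.eval_finsetSum]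
    refine Finset.sum_congr rfl fun j hj => ?_
    have hj' : j ≤ N := Nat.lt_succ_iff.1 (Finset.mem_range.1 hj)
    rw [Polynomial.eval_mul, Polynomial.eval_C, hv, hT _ _ (hmem j hj'), hcheb _ j hj',
      hcheb _ j hj', cos_aliasIndex_mul N n hN]
  have h := hasSum_sum fun j (hj : j ∈ Finset.range (N + 1)) =>
    (hf _ (hmem j (Nat.lt_succ_iff.1 (Finset.mem_range.1 hj)))).mul_right
      ((Lagrange.basis (Finset.range (N + 1)) v j).eval (x : ℂ))
  rw [ccInterpolant, Lagrange.interpolate_apply, Polynomial.eval_finsetSum]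
  simp only [Polynomial.eval_mul, Polynomial.eval_C]
  simpa only [hrepr, Finset.mul_sum, mul_assoc] using h

/-! ### Functions of power type at the origin. -/

/-- `U` is twice differentiable on `(0, b]`, and its `i`-th derivative is `O(x ^ (γ - i))` for
`i = 0, 1, 2`. -/
def IsPowerSymbol (γ b : ℝ) (U : ℝ → ℂ) : Prop :=
  ∃ (U' U'' : ℝ → ℂ) (C₀ C₁ C₂ : ℝ), ∀ x ∈ Ioc 0 b,
    HasDerivAt U (U' x) x ∧ HasDerivAt U' (U'' x) x ∧
    ‖U x‖ ≤ C₀ * x ^ γ ∧ ‖U' x‖ ≤ C₁ * x ^ (γ - 1) ∧ ‖U'' x‖ ≤ C₂ * x ^ (γ - 2)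

namespace IsPowerSymbol

theorem nonneg_of_norm_le {E : Type*} [SeminormedAddGroup E] {u : E} {C x γ : ℝ} (hx : 0 < x)
    (h : ‖u‖ ≤ C * x ^ γ) : 0 ≤ C :=
  nonneg_of_mul_nonneg_left ((norm_nonneg _).trans h) (Real.rpow_pos_of_pos hx γ)

theorem continuousOn {γ b : ℝ} {U : ℝ → ℂ} (hU : IsPowerSymbol γ b U) :
    ContinuousOn U (Ioc 0 b) := by
  obtain ⟨U', U'', C₀, C₁, C₂, h⟩ := hU
  exact fun x hx => (h x hx).1.continuousAt.continuousWithinAt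

theorem congr {γ b : ℝ} {U V : ℝ → ℂ} (hU : IsPowerSymbol γ b U) (h : ∀ x, 0 < x → V x = U x) :
    IsPowerSymbol γ b V := by
  obtain ⟨U', U'', C₀, C₁, C₂, hU⟩ := hU
  refine ⟨U', U'', C₀, C₁, C₂, fun x hx => ?_⟩
  obtain ⟨h0, h1, h2, h3, h4⟩ := hU x hx
  refine ⟨h0.congr_of_eventuallyEq ?_, h1, by rwa [h x hx.1], h3, h4⟩
  filter_upwards [lt_mem_nhds hx.1] with y hy using h y hy

theorem mul {γ δ b : ℝ} {U V : ℝ → ℂ} (hU : IsPowerSymbol γ b U) (hV : IsPowerSymbol δ b V) :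
    IsPowerSymbol (γ + δ) b (fun x => U x * V x) := by
  obtain ⟨U', U'', C₀, C₁, C₂, hU⟩ := hU
  obtain ⟨V', V'', D₀, D₁, D₂, hV⟩ := hV
  refine ⟨fun x => U' x * V x + U x * V' x,
    fun x => (U'' x * V x + U' x * V' x) + (U' x * V' x + U x * V'' x),
    C₀ * D₀, C₁ * D₀ + C₀ * D₁, C₂ * D₀ + C₁ * D₁ + (C₁ * D₁ + C₀ * D₂), fun x hx => ?_⟩
  obtain ⟨u0, u1, u2, u3, u4⟩ := hU x hx
  obtain ⟨v0, v1, v2, v3, v4⟩ := hV x hx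
  have key : ∀ {p q : ℂ} {C D s t r : ℝ}, ‖p‖ ≤ C * x ^ s → ‖q‖ ≤ D * x ^ t → s + t = r →
      ‖p * q‖ ≤ C * D * x ^ r := by
    intro p q C D s t r hp hq hr
    rw [norm_mul, ← hr, Real.rpow_add hx.1]
    calc _ ≤ (C * x ^ s) * (D * x ^ t) :=
          mul_le_mul hp hq (norm_nonneg _) ((norm_nonneg _).trans hp)
      _ = _ := by ring
  have add : ∀ {p q : ℂ} {C D s : ℝ}, ‖p‖ ≤ C * x ^ s → ‖q‖ ≤ D * x ^ s →
      ‖p + q‖ ≤ (C + D) * x ^ s := by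
    intro p q C D s hp hq
    rw [add_mul]
    exact (norm_add_le _ _).trans (add_le_add hp hq)
  exact ⟨u0.mul v0, (u1.mul v0).add (u0.mul v1), key u2 v2 rfl,
    add (key u3 v2 (by ring)) (key u2 v3 (by ring)),
    add (add (key u4 v2 (by ring)) (key u3 v3 (by ring)))
      (add (key u3 v3 (by ring)) (key u2 v4 (by ring)))⟩

theorem mono {γ δ b : ℝ} {U : ℝ → ℂ} (hU : IsPowerSymbol γ b U) (h : δ ≤ γ) :
    IsPowerSymbol δ b U := by
  obtain ⟨U', U'', C₀, C₁, C₂, hU⟩ := hU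
  refine ⟨U', U'', C₀ * b ^ (γ - δ), C₁ * b ^ (γ - δ), C₂ * b ^ (γ - δ), fun x hx => ?_⟩
  obtain ⟨u0, u1, u2, u3, u4⟩ := hU x hx
  have key : ∀ {p : ℂ} {C s t : ℝ}, ‖p‖ ≤ C * x ^ s → s = γ - δ + t →
      ‖p‖ ≤ C * b ^ (γ - δ) * x ^ t := by
    intro p C s t hp hs
    have hC := nonneg_of_norm_le hx.1 hp
    rw [hs, Real.rpow_add hx.1, ← mul_assoc] at hp
    refine hp.trans ?_
    have : x ^ (γ - δ) ≤ b ^ (γ - δ) := Real.rpow_le_rpow hx.1.le hx.2 (by linarith)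
    have hx' := Real.rpow_nonneg hx.1.le t
    gcongr
  exact ⟨u0, u1, key u2 (by ring), key u3 (by ring), key u4 (by ring)⟩

/-- Composition with `angleNode` doubles the order. -/
theorem comp_angleNode {γ b : ℝ} (hb : 0 < b) {U : ℝ → ℂ} (hU : IsPowerSymbol γ b U) :
    IsPowerSymbol (2 * γ) Real.pi (fun φ => U (angleNode b φ)) := by
  obtain ⟨U', U'', C₀, C₁, C₂, hU⟩ := hU
  have hpi := Real.pi_pos
  -- Since `x(φ)` lies between `(b/π²) φ²` and `(b/4) φ²`, the sum of both powers bounds `x(φ)^s /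
  -- φ^(2s)` for either sign of `s`.
  set K : ℝ → ℝ := fun s => (b / Real.pi ^ 2) ^ s + (b / 4) ^ s with hK
  refine ⟨fun φ => (b / 2 * Real.sin φ) • U' (angleNode b φ),
    fun φ => (b / 2 * Real.sin φ) • ((b / 2 * Real.sin φ) • U'' (angleNode b φ)) +
      (b / 2 * Real.cos φ) • U' (angleNode b φ),
    C₀ * K γ, b / 2 * (C₁ * K (γ - 1)),
    b / 2 * (b / 2 * (C₂ * K (γ - 2))) + b / 2 * (C₁ * K (γ - 1)), fun φ hφ => ?_⟩
  have hlow : b / Real.pi ^ 2 * φ ^ 2 ≤ angleNode b φ := by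
    have h1 := Real.cos_le_one_sub_mul_cos_sq (x := φ) (by rw [abs_of_pos hφ.1]; exact hφ.2)
    unfold angleNode
    have h2 : b / 2 * Real.cos φ ≤ b / 2 * (1 - 2 / Real.pi ^ 2 * φ ^ 2) := by gcongr
    have h3 : b / 2 * (1 - 2 / Real.pi ^ 2 * φ ^ 2) = b / 2 - b / Real.pi ^ 2 * φ ^ 2 := by
      field_simp
    linarith
  have hupp : angleNode b φ ≤ b / 4 * φ ^ 2 := by
    have h1 := Real.one_sub_sq_div_two_le_cos (x := φ)
    unfold angleNode
    nlinarith
  have hφ2 : 0 < φ ^ 2 := by have := hφ.1; positivity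
  have hpos : 0 < angleNode b φ := lt_of_lt_of_le (by positivity) hlow
  have hpow : ∀ s : ℝ, (angleNode b φ) ^ s ≤ K s * φ ^ (2 * s) := by
    intro s
    have e : ∀ c : ℝ, 0 < c → (c * φ ^ 2) ^ s = c ^ s * φ ^ (2 * s) := by
      intro c hc
      rw [Real.mul_rpow hc.le hφ2.le, ← Real.rpow_natCast, ← Real.rpow_mul hφ.1.le]; norm_num
    simp only [hK]
    rw [add_mul, ← e _ (by positivity), ← e _ (by positivity)]
    rcases le_total 0 s with hs | hs
    · have := Real.rpow_le_rpow hpos.le hupp hs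
      have h2 : 0 ≤ (b / Real.pi ^ 2 * φ ^ 2) ^ s := by positivity
      linarith
    · have := Real.rpow_le_rpow_of_nonpos (by positivity) hlow hs
      have h2 : 0 ≤ (b / 4 * φ ^ 2) ^ s := by positivity
      linarith
  obtain ⟨u0, u1, u2, u3, u4⟩ := hU _ ⟨hpos, (angleNode_mem b hb φ).2⟩
  have hx := hasDerivAt_angleNode b φ
  have key : ∀ {p : ℂ} {C s t : ℝ}, ‖p‖ ≤ C * (angleNode b φ) ^ s → 2 * s = t →
      ‖p‖ ≤ C * K s * φ ^ t := by
    intro p C s t hp ht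
    have hC := nonneg_of_norm_le hpos hp
    rw [← ht, mul_assoc]
    exact hp.trans (mul_le_mul_of_nonneg_left (hpow s) hC)
  -- Each factor `sin φ` from the chain rule restores one power of `φ`.
  have hsin : ∀ {p : ℂ} {C s t : ℝ}, ‖p‖ ≤ C * φ ^ s → s + 1 = t →
      ‖(b / 2 * Real.sin φ) • p‖ ≤ b / 2 * C * φ ^ t := by
    intro p C s t hp ht
    have h0 : |Real.sin φ| ≤ φ := by simpa [abs_of_pos hφ.1] using Real.abs_sin_le_abs (x := φ)
    rw [norm_smul, norm_mul, Real.norm_eq_abs, Real.norm_eq_abs, abs_of_pos (by positivity), ← ht,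
      Real.rpow_add hφ.1, Real.rpow_one]
    calc _ ≤ b / 2 * φ * (C * φ ^ s) := by gcongr; exact mul_nonneg (by positivity) hφ.1.le
      _ = _ := by ring
  have hcos : ∀ {p : ℂ} {C s : ℝ}, ‖p‖ ≤ C * φ ^ s →
      ‖(b / 2 * Real.cos φ) • p‖ ≤ b / 2 * C * φ ^ s := by
    intro p C s hp
    rw [norm_smul, norm_mul, Real.norm_eq_abs, Real.norm_eq_abs, abs_of_pos (by positivity),
      mul_assoc (b / 2) C]
    calc _ ≤ b / 2 * 1 * (C * φ ^ s) := by gcongr; exact Real.abs_cos_le_one φ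
      _ = _ := by ring
  have u3' := key u3 (show 2 * (γ - 1) = 2 * γ - 2 by ring)
  have u4' := key u4 (show 2 * (γ - 2) = 2 * γ - 4 by ring)
  refine ⟨HasDerivAt.scomp (𝕜 := ℝ) φ u0 hx, ?_, key u2 rfl, hsin u3' (by ring), ?_⟩
  · exact ((Real.hasDerivAt_sin φ).const_mul (b / 2)).smul (HasDerivAt.scomp (𝕜 := ℝ) φ u1 hx)
  · rw [add_mul]
    exact (norm_add_le _ _).trans
      (add_le_add (hsin (hsin u4' rfl) (by ring)) (hcos u3'))

theorem cos_half : IsPowerSymbol 0 Real.pi (fun φ => ((Real.cos (φ / 2) : ℝ) : ℂ)) := by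
  refine ⟨fun φ => ((-(Real.sin (φ / 2)) * (1 / 2) : ℝ) : ℂ),
    fun φ => ((-(Real.cos (φ / 2) * (1 / 2)) * (1 / 2) : ℝ) : ℂ), 1, Real.pi, Real.pi ^ 2,
    fun φ hφ => ?_⟩
  have hpi := Real.pi_pos
  have h0 : HasDerivAt (fun φ : ℝ => φ / 2) (1 / 2) φ := (hasDerivAt_id φ).div_const 2
  have p1 : φ ^ ((0 : ℝ) - 1) = φ⁻¹ := by rw [zero_sub, Real.rpow_neg_one]
  have p2 : φ ^ ((0 : ℝ) - 2) = (φ ^ 2)⁻¹ := by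
    rw [zero_sub, Real.rpow_neg hφ.1.le]; norm_num
  have s := Real.abs_sin_le_one (φ / 2)
  have c := Real.abs_cos_le_one (φ / 2)
  refine ⟨h0.cos.ofReal_comp, (h0.sin.neg.mul_const (1 / 2)).ofReal_comp, ?_, ?_, ?_⟩
  · rw [Complex.norm_real, Real.rpow_zero, mul_one]; exact c
  · have h1 : 1 ≤ Real.pi * φ⁻¹ := by
      rw [← div_eq_mul_inv, le_div_iff₀ hφ.1, one_mul]; exact hφ.2
    rw [Complex.norm_real, p1, norm_mul, norm_neg, Real.norm_eq_abs, Real.norm_eq_abs]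
    rw [abs_of_pos (by norm_num : (0 : ℝ) < 1 / 2)]
    linarith
  · have h1 : 1 ≤ Real.pi ^ 2 * (φ ^ 2)⁻¹ := by
      rw [← div_eq_mul_inv, ← div_pow]
      exact one_le_pow₀ (by rw [le_div_iff₀ hφ.1, one_mul]; exact hφ.2)
    rw [Complex.norm_real, p2, norm_mul, norm_neg, norm_mul, Real.norm_eq_abs, Real.norm_eq_abs]
    rw [abs_of_pos (by norm_num : (0 : ℝ) < 1 / 2)]
    linarith

/-- Decay of the sine coefficients by two integrations by parts away from the singularity. -/
theorem norm_integral_mul_sin_le {δ : ℝ} (h0 : 0 < δ) (h1 : δ < 1) {V : ℝ → ℂ}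
    (hV : IsPowerSymbol δ Real.pi V) (hVpi : V Real.pi = 0) :
    ∃ C, ∀ n : ℕ, ‖∫ φ in (0 : ℝ)..Real.pi, V φ * ((Real.sin ((n + 1 / 2) * φ) : ℝ) : ℂ)‖ ≤
      C * (1 / ((n : ℝ) + 1)) ^ (1 + δ) := by
  have hcont := hV.continuousOn
  obtain ⟨V', V'', C₀, C₁, C₂, hV⟩ := hV
  have hpi := Real.pi_pos
  have hpimem : Real.pi ∈ Ioc 0 Real.pi := ⟨hpi, le_rfl⟩
  have hC₀ : 0 ≤ C₀ := nonneg_of_norm_le hpi (hV _ hpimem).2.2.1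
  have hC₁ : 0 ≤ C₁ := nonneg_of_norm_le hpi (hV _ hpimem).2.2.2.1
  have hC₂ : 0 ≤ C₂ := nonneg_of_norm_le hpi (hV _ hpimem).2.2.2.2
  have hVint : IntervalIntegrable V volume 0 Real.pi := by
    rw [intervalIntegrable_iff_integrableOn_Ioc_of_le hpi.le]
    refine Integrable.of_bound (hcont.aestronglyMeasurable measurableSet_Ioc) (C₀ * Real.pi ^ δ)
      ((ae_restrict_iff' measurableSet_Ioc).2 (Filter.Eventually.of_forall fun x hx => ?_))
    refine (hV x hx).2.2.1.trans ?_
    gcongr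
    exacts [hx.1.le, hx.2]
  refine ⟨C₀ + (2 * C₀ + 4 * C₁ + 4 * C₁ + 4 * (C₂ / (1 - δ))), fun n => ?_⟩
  set ν : ℝ := n + 1 / 2 with hν
  -- The integral is split at the scale of one oscillation: on `[0, ε]` the size of `V` alone gives
  -- `ε^(1+δ)`.
  set ε : ℝ := 1 / ((n : ℝ) + 1) with hε
  have hν0 : 0 < ν := by positivity
  have hε0 : 0 < ε := by positivity
  have hε1 : ε ≤ 1 := by
    rw [hε, div_le_one (by positivity)]; linarith [Nat.cast_nonneg (α := ℝ) n]
  have hεpi : ε ≤ Real.pi := hε1.trans (by linarith [Real.pi_gt_three])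
  have hνε : 1 / ν ≤ 2 * ε := by
    rw [hε, hν, mul_one_div, div_le_div_iff₀ (by positivity) (by positivity)]
    linarith [Nat.cast_nonneg (α := ℝ) n]
  have hsinc : Continuous fun φ : ℝ => ((Real.sin (ν * φ) : ℝ) : ℂ) := by fun_prop
  have hfull := hVint.mul_continuousOn (hsinc.continuousOn (s := uIcc 0 Real.pi))
  have hsub1 : uIcc 0 ε ⊆ uIcc 0 Real.pi := by
    rw [uIcc_of_le hε0.le, uIcc_of_le hpi.le]; exact Icc_subset_Icc_right hεpi
  have hsub2 : uIcc ε Real.pi ⊆ uIcc 0 Real.pi := by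
    rw [uIcc_of_le hεpi, uIcc_of_le hpi.le]; exact Icc_subset_Icc_left hε0.le
  rw [← intervalIntegral.integral_add_adjacent_intervals (hfull.mono_set hsub1)
    (hfull.mono_set hsub2)]
  have hpow1 : ε ^ (1 + δ) = ε ^ δ * ε := by
    rw [add_comm, Real.rpow_add hε0, Real.rpow_one]
  have hpow2 : ε ^ (1 + δ) = ε ^ (δ - 1) * ε ^ 2 := by
    rw [← Real.rpow_natCast, ← Real.rpow_add hε0]; congr 1; norm_num; ring
  have hnear : ‖∫ φ in (0 : ℝ)..ε, V φ * ((Real.sin (ν * φ) : ℝ) : ℂ)‖ ≤ C₀ * ε ^ (1 + δ) := by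
    have := intervalIntegral.norm_integral_le_of_norm_le_const (a := 0) (b := ε) (C := C₀ * ε ^ δ)
      (f := fun φ => V φ * ((Real.sin (ν * φ) : ℝ) : ℂ)) (fun x hx => ?_)
    · rw [sub_zero, abs_of_pos hε0] at this
      rw [hpow1, ← mul_assoc]; exact this
    · rw [uIoc_of_le hε0.le] at hx
      rw [norm_mul, Complex.norm_real]
      calc _ ≤ C₀ * ε ^ δ * 1 := by
            gcongr
            · refine (hV x ⟨hx.1, hx.2.trans hεpi⟩).2.2.1.trans ?_
              gcongr
              exacts [hx.1.le, hx.2]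
            · exact Real.abs_sin_le_one _
        _ = _ := mul_one _
  have hmemI : ∀ x ∈ Icc ε Real.pi, x ∈ Ioc 0 Real.pi := fun x hx => ⟨hε0.trans_le hx.1, hx.2⟩
  have hV''int : IntervalIntegrable V'' volume ε Real.pi := by
    rw [intervalIntegrable_iff_integrableOn_Icc_of_le hεpi]
    have hmeas : AEStronglyMeasurable V'' (volume.restrict (Icc ε Real.pi)) := by
      refine ((measurable_deriv V').aestronglyMeasurable).congr ?_
      filter_upwards [ae_restrict_mem measurableSet_Icc] with x hx
        using (hV x (hmemI x hx)).2.1.deriv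
    refine Integrable.of_bound hmeas (C₂ * ε ^ (δ - 2))
      ((ae_restrict_iff' measurableSet_Icc).2 (Filter.Eventually.of_forall fun x hx => ?_))
    refine (hV x (hmemI x hx)).2.2.2.2.trans ?_
    exact mul_le_mul_of_nonneg_left
      (Real.rpow_le_rpow_of_nonpos hε0 hx.1 (by linarith)) hC₂
  have hV''sin := hV''int.mul_continuousOn (hsinc.continuousOn (s := uIcc ε Real.pi))
  -- `W` has derivative `V sin(νφ) + V'' sin(νφ)/ν²`, so it performs both integrations by parts at
  -- once. As `V π = 0`, its term of order `1/ν` is absent at `π`.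
  set W : ℝ → ℂ := fun φ => -(V φ * ((Real.cos (ν * φ) : ℝ) : ℂ)) * (1 / ν : ℝ) +
    V' φ * ((Real.sin (ν * φ) : ℝ) : ℂ) * ((1 / ν) ^ 2 : ℝ) with hW
  have hft : ∫ φ in ε..Real.pi, (V φ * ((Real.sin (ν * φ) : ℝ) : ℂ) +
      V'' φ * ((Real.sin (ν * φ) : ℝ) : ℂ) * ((1 / ν) ^ 2 : ℝ)) = W Real.pi - W ε := by
    refine intervalIntegral.integral_eq_sub_of_hasDerivAt (fun x hx => ?_)
      ((hfull.mono_set hsub2).add (hV''sin.mul_const _))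
    rw [uIcc_of_le hεpi] at hx
    obtain ⟨d0, d1, -⟩ := hV x (hmemI x hx)
    have l : HasDerivAt (fun φ : ℝ => ν * φ) ν x := by
      simpa using (hasDerivAt_id x).const_mul ν
    have c := l.cos.ofReal_comp
    have s := l.sin.ofReal_comp
    have := ((d0.mul c).neg.mul_const ((1 / ν : ℝ) : ℂ)).add
      ((d1.mul s).mul_const (((1 / ν) ^ 2 : ℝ) : ℂ))
    refine this.congr_deriv ?_
    have hνC : (ν : ℂ) ≠ 0 := by exact_mod_cast hν0.ne'
    push_cast
    field_simp
    ring
  rw [intervalIntegral.integral_add (hfull.mono_set hsub2) (hV''sin.mul_const _),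
    intervalIntegral.integral_mul_const] at hft
  -- Because `δ < 1`, the integral of `φ^(δ-2)` is controlled by its lower end `ε`.
  have hV''bd : ‖∫ φ in ε..Real.pi, V'' φ * ((Real.sin (ν * φ) : ℝ) : ℂ)‖ ≤
      C₂ / (1 - δ) * ε ^ (δ - 1) := by
    have hr : IntervalIntegrable (fun φ : ℝ => C₂ * φ ^ (δ - 2)) volume ε Real.pi := by
      refine ContinuousOn.intervalIntegrable fun x hx => ?_
      rw [uIcc_of_le hεpi] at hx
      exact (continuousAt_const.mul (Real.continuousAt_rpow_const _ _
        (Or.inl (hε0.trans_le hx.1).ne'))).continuousWithinAt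
    refine (intervalIntegral.norm_integral_le_of_norm_le hεpi
      (g := fun φ => C₂ * φ ^ (δ - 2)) (Filter.Eventually.of_forall fun x hx => ?_) hr).trans ?_
    · have hx' := (hV x ⟨hε0.trans hx.1, hx.2⟩).2.2.2.2
      rw [norm_mul, Complex.norm_real]
      calc _ ≤ ‖V'' x‖ * 1 := by gcongr; exact Real.abs_sin_le_one _
        _ ≤ _ := by rw [mul_one]; exact hx'
    · rw [intervalIntegral.integral_const_mul, integral_rpow (Or.inr ⟨by linarith, by
        rw [uIcc_of_le hεpi]; exact fun h => absurd h.1 (by linarith)⟩)]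
      have hd : 0 < 1 - δ := by linarith
      have e : (Real.pi ^ (δ - 2 + 1) - ε ^ (δ - 2 + 1)) / (δ - 2 + 1) =
          (ε ^ (δ - 1) - Real.pi ^ (δ - 1)) / (1 - δ) := by
        rw [show δ - 2 + 1 = -(1 - δ) by ring, show δ - 1 = -(1 - δ) by ring, div_neg, ← neg_div,
          neg_sub]
      rw [e]
      have : 0 ≤ Real.pi ^ (δ - 1) := by positivity
      calc _ ≤ C₂ * (ε ^ (δ - 1) / (1 - δ)) := by gcongr; linarith
        _ = _ := by ring
  have hsq : (1 / ν) ^ 2 ≤ 4 * ε ^ 2 := by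
    calc _ ≤ (2 * ε) ^ 2 := by gcongr
      _ = _ := by ring
  have hV'bd : ∀ x ∈ Icc ε Real.pi,
      ‖V' x * ((Real.sin (ν * x) : ℝ) : ℂ) * ((1 / ν) ^ 2 : ℝ)‖ ≤ 4 * C₁ * ε ^ (1 + δ) := by
    intro x hx
    rw [norm_mul, norm_mul, Complex.norm_real, Complex.norm_real, Real.norm_of_nonneg
      (by positivity : 0 ≤ (1 / ν) ^ 2), hpow2]
    calc _ ≤ C₁ * ε ^ (δ - 1) * 1 * (4 * ε ^ 2) := by
          gcongr
          · refine (hV x (hmemI x hx)).2.2.2.1.trans ?_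
            exact mul_le_mul_of_nonneg_left
              (Real.rpow_le_rpow_of_nonpos hε0 hx.1 (by linarith)) hC₁
          · exact Real.abs_sin_le_one _
      _ = _ := by ring
  have hVbd : ‖-(V ε * ((Real.cos (ν * ε) : ℝ) : ℂ)) * (1 / ν : ℝ)‖ ≤ 2 * C₀ * ε ^ (1 + δ) := by
    rw [norm_mul, norm_neg, norm_mul, Complex.norm_real, Complex.norm_real, Real.norm_of_nonneg
      (by positivity : 0 ≤ 1 / ν), hpow1]
    calc _ ≤ C₀ * ε ^ δ * 1 * (2 * ε) := by
          gcongr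
          · exact (hV ε ⟨hε0, hεpi⟩).2.2.1
          · exact Real.abs_cos_le_one _
      _ = _ := by ring
  have hWpi : ‖W Real.pi‖ ≤ 4 * C₁ * ε ^ (1 + δ) := by
    simp only [hW, hVpi, zero_mul, neg_zero, zero_add]
    exact hV'bd _ ⟨hεpi, le_rfl⟩
  have hWε : ‖W ε‖ ≤ 2 * C₀ * ε ^ (1 + δ) + 4 * C₁ * ε ^ (1 + δ) :=
    (norm_add_le _ _).trans (add_le_add hVbd (hV'bd _ ⟨le_rfl, hεpi⟩))
  have hlast : ‖(∫ φ in ε..Real.pi, V'' φ * ((Real.sin (ν * φ) : ℝ) : ℂ)) * ((1 / ν) ^ 2 : ℝ)‖ ≤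
      4 * (C₂ / (1 - δ)) * ε ^ (1 + δ) := by
    rw [norm_mul, Complex.norm_real, Real.norm_of_nonneg (by positivity : 0 ≤ (1 / ν) ^ 2), hpow2]
    have hd : 0 < 1 - δ := by linarith
    calc _ ≤ C₂ / (1 - δ) * ε ^ (δ - 1) * (4 * ε ^ 2) := by gcongr
      _ = _ := by ring
  have hfar : ‖∫ φ in ε..Real.pi, V φ * ((Real.sin (ν * φ) : ℝ) : ℂ)‖ ≤
      (2 * C₀ + 4 * C₁ + 4 * C₁ + 4 * (C₂ / (1 - δ))) * ε ^ (1 + δ) := by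
    rw [eq_sub_of_add_eq hft]
    have t1 := norm_sub_le (W Real.pi - W ε)
      ((∫ φ in ε..Real.pi, V'' φ * ((Real.sin (ν * φ) : ℝ) : ℂ)) * ((1 / ν) ^ 2 : ℝ))
    have t2 := norm_sub_le (W Real.pi) (W ε)
    linarith
  refine (norm_add_le _ _).trans ?_
  rw [add_mul]
  exact add_le_add hnear hfar

end IsPowerSymbol

/-! ### Moments of the weight. -/

/-- The moments of the weight `w` with respect to the Chebyshev polynomials on `[0, b]`. -/
def chebyshevMoment (b : ℝ) (w : ℝ → ℂ) (n : ℕ) : ℂ :=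
  ∫ x in (0 : ℝ)..b, w x * (shiftedChebyshev b n x : ℂ)

theorem IsPowerSymbol.intervalIntegrable_div {γ b : ℝ} (hb : 0 < b) (h0 : 0 < γ) {w : ℝ → ℂ}
    (hw : IsPowerSymbol γ b (fun x => x * w x)) : IntervalIntegrable w volume 0 b := by
  have hcont := hw.continuousOn
  obtain ⟨U', U'', C₀, C₁, C₂, hU⟩ := hw
  have hwc : ContinuousOn w (Ioc 0 b) := by
    have h1 : ContinuousOn (fun x : ℝ => ((x : ℂ))⁻¹ * (x * w x)) (Ioc 0 b) := by
      refine ContinuousOn.mul (ContinuousOn.inv₀ (by fun_prop) fun x hx => ?_) hcont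
      exact_mod_cast hx.1.ne'
    refine h1.congr fun x hx => ?_
    have : (x : ℂ) ≠ 0 := by exact_mod_cast hx.1.ne'
    field_simp
  have hr : IntervalIntegrable (fun x : ℝ => C₀ * x ^ (γ - 1)) volume 0 b :=
    (intervalIntegral.intervalIntegrable_rpow' (by linarith)).const_mul C₀
  rw [intervalIntegrable_iff_integrableOn_Ioc_of_le hb.le] at hr ⊢
  refine Integrable.mono' hr (hwc.aestronglyMeasurable measurableSet_Ioc)
    ((ae_restrict_iff' measurableSet_Ioc).2 (Filter.Eventually.of_forall fun x hx => ?_))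
  have h1 := (hU x hx).2.2.1
  rw [norm_mul, Complex.norm_real, Real.norm_of_nonneg hx.1.le] at h1
  rw [Real.rpow_sub_one hx.1.ne', ← mul_div_assoc, le_div_iff₀ hx.1, mul_comm]
  exact h1

/-- Taking differences of moments gains a factor `sin (φ/2)`, which with `dx = (b/2) sin φ dφ`
combines to `x cos (φ/2)`, as `x = b sin² (φ/2)`. So only `x w(x)` enters, of order `2γ` in `φ`, and
the difference is `O(n^(-1-2γ))`. The factor `cos (φ/2)` makes the integrand vanish at `π`. -/
theorem IsPowerSymbol.summable_norm_chebyshevMoment_sub {γ b : ℝ} (hb : 0 < b) (h0 : 0 < γ)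
    (h1 : γ < 1 / 2) {w : ℝ → ℂ} (hw : IsPowerSymbol γ b (fun x => x * w x)) :
    Summable fun n => ‖chebyshevMoment b w (n + 1) - chebyshevMoment b w n‖ := by
  have hpi := Real.pi_pos
  have hint := IsPowerSymbol.intervalIntegrable_div hb h0 hw
  have hV := ((hw.comp_angleNode hb).mul IsPowerSymbol.cos_half).mono
    (show 2 * γ ≤ 2 * γ + 0 by linarith)
  obtain ⟨C, hC⟩ := hV.norm_integral_mul_sin_le (by linarith) (by linarith)
    (by simp [Real.cos_pi_div_two])
  have hmom : ∀ n, chebyshevMoment b w (n + 1) - chebyshevMoment b w n =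
      -2 * ∫ φ in (0 : ℝ)..Real.pi, (angleNode b φ * w (angleNode b φ) *
        ((Real.cos (φ / 2) : ℝ) : ℂ)) * ((Real.sin ((n + 1 / 2) * φ) : ℝ) : ℂ) := by
    intro n
    have hT : ∀ m, Continuous fun x => (shiftedChebyshev b m x : ℂ) := fun m =>
      Complex.continuous_ofReal.comp (continuous_shiftedChebyshev b m)
    unfold chebyshevMoment
    rw [← intervalIntegral.integral_sub (hint.mul_continuousOn (hT _).continuousOn)
      (hint.mul_continuousOn (hT _).continuousOn)]
    have hsub := integral_Icc_deriv_smul_of_deriv_nonneg (f := angleNode b)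
      (f' := fun φ => b / 2 * Real.sin φ) (a := 0) (b := Real.pi)
      (g := fun x => w x * (shiftedChebyshev b (n + 1) x : ℂ) - w x * (shiftedChebyshev b n x : ℂ))
      (continuous_angleNode b).continuousOn (fun φ _ => hasDerivAt_angleNode b φ)
      (fun φ hφ => mul_nonneg (by positivity) (Real.sin_pos_of_mem_Ioo hφ).le) hpi.le
    rw [show angleNode b 0 = 0 by simp [angleNode],
      show angleNode b Real.pi = b by simp [angleNode]] at hsub
    rw [intervalIntegral.integral_of_le hb.le, ← integral_Icc_eq_integral_Ioc, ← hsub,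
      ← intervalIntegral.integral_const_mul, intervalIntegral.integral_of_le hpi.le,
      ← integral_Icc_eq_integral_Ioc]
    refine setIntegral_congr_fun measurableSet_Icc fun φ hφ => ?_
    have e : ∀ m : ℕ, shiftedChebyshev b m (angleNode b φ) = Real.cos (m * φ) := fun m => by
      rw [shiftedChebyshev, arccos_angleNode b hb φ hφ]
    have e1 : Real.cos ((n + 1 : ℕ) * φ) - Real.cos (n * φ) =
        -2 * Real.sin ((n + 1 / 2) * φ) * Real.sin (φ / 2) := by
      rw [Real.cos_sub_cos]; push_cast; ring_nf
    have e2 : Real.sin φ = 2 * Real.sin (φ / 2) * Real.cos (φ / 2) := by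
      rw [← Real.sin_two_mul]; ring_nf
    have e3 : angleNode b φ = b * Real.sin (φ / 2) ^ 2 := by
      rw [angleNode, Real.sin_sq_eq_half_sub, mul_div_cancel₀ _ two_ne_zero]; ring
    have hfac : b / 2 * Real.sin φ * (Real.cos ((n + 1 : ℕ) * φ) - Real.cos (n * φ)) =
        -2 * (angleNode b φ * Real.cos (φ / 2) * Real.sin ((n + 1 / 2) * φ)) := by
      rw [e1, e2, e3]; ring
    have hfacC : ((b / 2 * Real.sin φ : ℝ) : ℂ) *
        ((Real.cos ((n + 1 : ℕ) * φ) : ℝ) - (Real.cos (n * φ) : ℝ) : ℂ) =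
        -2 * ((angleNode b φ : ℝ) * (Real.cos (φ / 2) : ℝ) *
          (Real.sin ((n + 1 / 2) * φ) : ℝ) : ℂ) := by
      exact_mod_cast congrArg Complex.ofReal hfac
    simp only [e, Complex.real_smul]
    linear_combination w (angleNode b φ) * hfacC
  have hs : Summable fun n : ℕ => 2 * (C * (1 / ((n : ℝ) + 1)) ^ (1 + 2 * γ)) := by
    refine (Summable.mul_left C ?_).mul_left 2
    have := (summable_nat_add_iff 1).2
      (Real.summable_one_div_nat_rpow.2 (show 1 < 1 + 2 * γ by linarith))
    refine this.congr fun n => ?_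
    rw [Real.div_rpow zero_le_one (by positivity), Real.one_rpow]
    push_cast
    rfl
  refine Summable.of_nonneg_of_le (fun _ => norm_nonneg _) (fun n => ?_) hs
  rw [hmom, norm_mul, norm_neg, Complex.norm_ofNat]
  exact mul_le_mul_of_nonneg_left (hC n) (by norm_num)

/-! ### The Bessel weights, with and without logarithm. -/

namespace IsPowerSymbol

theorem cpow (b : ℝ) (z : ℂ) : IsPowerSymbol z.re b (fun x => (x : ℂ) ^ z) := by
  have hd : ∀ (z : ℂ) (x : ℝ), 0 < x →
      HasDerivAt (fun x : ℝ => (x : ℂ) ^ z) (z * (x : ℂ) ^ (z - 1)) x := fun z x hx =>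
    (Complex.hasStrictDerivAt_cpow_const (Complex.ofReal_mem_slitPlane.2 hx)).hasDerivAt.comp_ofReal
  refine ⟨fun x => z * (x : ℂ) ^ (z - 1), fun x => z * ((z - 1) * (x : ℂ) ^ (z - 1 - 1)),
    1, ‖z‖, ‖z‖ * ‖z - 1‖, fun x hx => ⟨hd z x hx.1, (hd (z - 1) x hx.1).const_mul z, ?_, ?_, ?_⟩⟩
  · rw [Complex.norm_cpow_eq_rpow_re_of_pos hx.1, one_mul]
  · rw [norm_mul, Complex.norm_cpow_eq_rpow_re_of_pos hx.1]
    simp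
  · rw [norm_mul, norm_mul, Complex.norm_cpow_eq_rpow_re_of_pos hx.1, mul_assoc,
      show (z - 1 - 1).re = z.re - 2 by simp; ring]

theorem log {b ε : ℝ} (hε : 0 < ε) :
    IsPowerSymbol (-ε) b (fun x => ((Real.log x : ℝ) : ℂ)) := by
  -- In the first constant, `1/ε` bounds the logarithm from below near `0`, and `b^(2ε)/ε` bounds it
  -- from above through `x^ε ≤ b^(2ε) x^(-ε)`.
  refine ⟨fun x => ((x⁻¹ : ℝ) : ℂ), fun x => ((-(x ^ 2)⁻¹ : ℝ) : ℂ), b ^ (2 * ε) / ε + 1 / ε,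
    b ^ ε, b ^ ε, fun x hx => ⟨(Real.hasDerivAt_log hx.1.ne').ofReal_comp,
      (hasDerivAt_inv hx.1.ne').ofReal_comp, ?_, ?_, ?_⟩⟩
  · have h1 := Real.log_le_rpow_div hx.1.le hε
    have h2 := Real.log_le_rpow_div (inv_nonneg.2 hx.1.le) hε
    rw [Real.log_inv, Real.inv_rpow hx.1.le, ← Real.rpow_neg hx.1.le] at h2
    have h3 : x ^ ε ≤ b ^ (2 * ε) * x ^ (-ε) := by
      rw [show x ^ ε = x ^ (2 * ε) * x ^ (-ε) by rw [← Real.rpow_add hx.1]; ring_nf]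
      have h4 := hx.1.le
      have h5 := hx.2
      gcongr
    have h4 : 0 ≤ x ^ (-ε) / ε := by have := hx.1.le; positivity
    have h5 : 0 ≤ x ^ ε / ε := by have := hx.1.le; positivity
    have h6 : x ^ ε / ε ≤ b ^ (2 * ε) * x ^ (-ε) / ε := by gcongr
    rw [Complex.norm_real, Real.norm_eq_abs, add_mul, div_mul_eq_mul_div, div_mul_eq_mul_div,
      one_mul]
    exact abs_le.2 ⟨by linarith, by linarith⟩
  · have h4 := Real.rpow_nonneg hx.1.le (-ε - 1)
    have h5 := Real.rpow_le_rpow hx.1.le hx.2 hε.le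
    rw [Complex.norm_real, Real.norm_of_nonneg (inv_nonneg.2 hx.1.le), ← Real.rpow_neg_one,
      show x ^ (-1 : ℝ) = x ^ ε * x ^ (-ε - 1) by rw [← Real.rpow_add hx.1]; ring_nf]
    gcongr
  · have h4 := Real.rpow_nonneg hx.1.le (-ε - 2)
    have h5 := Real.rpow_le_rpow hx.1.le hx.2 hε.le
    rw [Complex.norm_real, norm_neg, Real.norm_of_nonneg (inv_nonneg.2 (sq_nonneg x)),
      ← Real.rpow_two, ← Real.rpow_neg hx.1.le,
      show x ^ (-2 : ℝ) = x ^ ε * x ^ (-ε - 2) by rw [← Real.rpow_add hx.1]; ring_nf]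
    gcongr

theorem of_differentiable (b : ℝ) {E : ℂ → ℂ} (hE : Differentiable ℂ E) :
    IsPowerSymbol 0 b (fun x => E x) := by
  have h1 : Differentiable ℂ (deriv E) := hE.contDiff.differentiable_deriv_two
  have h2 : Continuous (deriv (deriv E)) := h1.contDiff.continuous_deriv le_top
  have bd : ∀ F : ℂ → ℂ, Continuous F → ∃ C, ∀ x ∈ Icc 0 b, ‖F (x : ℝ)‖ ≤ C := fun F hF =>
    isCompact_Icc.exists_bound_of_continuousOn (f := fun x : ℝ => F x)
      (hF.comp Complex.continuous_ofReal).continuousOn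
  obtain ⟨C₀, hC₀⟩ := bd E hE.continuous
  obtain ⟨C₁, hC₁⟩ := bd _ h1.continuous
  obtain ⟨C₂, hC₂⟩ := bd _ h2
  refine ⟨fun x => deriv E x, fun x => deriv (deriv E) x, C₀, C₁ * b, C₂ * b ^ 2, fun x hx => ?_⟩
  have hx' : x ∈ Icc 0 b := Ioc_subset_Icc_self hx
  have n1 := (norm_nonneg _).trans (hC₁ x hx')
  have n2 := (norm_nonneg _).trans (hC₂ x hx')
  refine ⟨(hE x).hasDerivAt.comp_ofReal, (h1 x).hasDerivAt.comp_ofReal, ?_, ?_, ?_⟩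
  · rw [Real.rpow_zero, mul_one]; exact hC₀ x hx'
  · rw [zero_sub, Real.rpow_neg_one, mul_assoc, ← div_eq_mul_inv]
    exact (hC₁ x hx').trans (le_mul_of_one_le_right n1 ((one_le_div hx.1).2 hx.2))
  · rw [zero_sub, Real.rpow_neg hx.1.le, mul_assoc, ← div_eq_mul_inv, Real.rpow_two, ← div_pow]
    exact (hC₂ x hx').trans
      (le_mul_of_one_le_right n2 (one_le_pow₀ ((one_le_div hx.1).2 hx.2)))

end IsPowerSymbol

/-- By `Γ(s+1) = s Γ(s)` the modulus does not decrease once `Re s ≥ 1`, which holds from `n = 1` on;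
`n = 0` is kept apart because `Re (m+1)` may be below `1`. -/
theorem exists_pos_le_norm_Gamma (m : ℂ) (hm : -1 < m.re) :
    ∃ c > 0, ∀ n : ℕ, c ≤ ‖Complex.Gamma (n + m + 1)‖ := by
  have hpos : ∀ n : ℕ, 0 < ‖Complex.Gamma (n + m + 1)‖ := fun n => by
    rw [norm_pos_iff]
    refine Complex.Gamma_ne_zero_of_re_pos ?_
    have : (0 : ℝ) ≤ n := Nat.cast_nonneg n
    simp only [Complex.add_re, Complex.natCast_re, Complex.one_re]
    linarith
  have hstep : ∀ n : ℕ, ‖Complex.Gamma ((1 : ℕ) + m + 1)‖ ≤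
      ‖Complex.Gamma ((n + 1 : ℕ) + m + 1)‖ := by
    intro n
    induction n with
    | zero => simp
    | succ n ih =>
      have hre : 1 ≤ (((n + 1 : ℕ) : ℂ) + m + 1).re := by
        have : (0 : ℝ) ≤ n := Nat.cast_nonneg n
        simp only [Complex.add_re, Complex.natCast_re, Complex.one_re]
        push_cast
        linarith
      have hge := hre.trans (Complex.re_le_norm _)
      rw [show ((n + 1 + 1 : ℕ) : ℂ) + m + 1 = (((n + 1 : ℕ) : ℂ) + m + 1) + 1 by push_cast; ring,
        Complex.Gamma_add_one (((n + 1 : ℕ) : ℂ) + m + 1)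
          (by rw [← norm_pos_iff]; linarith), norm_mul]
      exact ih.trans (le_mul_of_one_le_left (norm_nonneg _) hge)
  refine ⟨min ‖Complex.Gamma ((0 : ℕ) + m + 1)‖ ‖Complex.Gamma ((1 : ℕ) + m + 1)‖,
    lt_min (hpos 0) (hpos 1), fun n => ?_⟩
  rcases n with _ | n
  · exact min_le_left _ _
  · exact (min_le_right _ _).trans (hstep n)

theorem differentiable_besselJ_series (m : ℂ) (hm : -1 < m.re) :
    Differentiable ℂ fun z : ℂ =>
      ∑' n : ℕ, (-1 : ℂ) ^ n / ((n.factorial : ℂ) * Complex.Gamma (n + m + 1)) *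
        (z / 2) ^ (2 * n) := by
  obtain ⟨c, hc, hΓ⟩ := exists_pos_le_norm_Gamma m hm
  intro z₀
  set R : ℝ := ‖z₀‖ + 1
  have hR : 0 < R := by positivity
  have hsum : Summable fun n : ℕ => c⁻¹ * (((R / 2) ^ 2) ^ n / (n.factorial : ℝ)) :=
    (Real.summable_pow_div_factorial _).mul_left _
  have hdiff := Complex.differentiableOn_tsum_of_summable_norm (U := Metric.ball 0 R)
    (F := fun (n : ℕ) (z : ℂ) => (-1 : ℂ) ^ n / ((n.factorial : ℂ) * Complex.Gamma (n + m + 1)) *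
        (z / 2) ^ (2 * n)) hsum (fun n => by fun_prop) Metric.isOpen_ball fun n z hz => ?_
  · exact hdiff.differentiableAt (Metric.isOpen_ball.mem_nhds (by simp [R]))
  · have hz' : ‖z‖ ≤ R := by simpa using (mem_ball_zero_iff.1 hz).le
    have hf : (0 : ℝ) < n.factorial := by exact_mod_cast n.factorial_pos
    rw [norm_mul, norm_div, norm_pow, norm_neg, norm_one, one_pow, norm_mul, Complex.norm_natCast,
      norm_pow, norm_div, Complex.norm_ofNat, pow_mul]
    calc _ ≤ 1 / ((n.factorial : ℝ) * c) * ((R / 2) ^ 2) ^ n := by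
          gcongr
          exact hΓ n
      _ = _ := by field_simp

/-- The weight times `x` is `x^(1+α+m)` times an entire function. -/
theorem isPowerSymbol_besselJ_weight {b ω α : ℝ} {m : ℂ} (hω : 0 < ω)
    (hm : -1 < m.re) :
    IsPowerSymbol (1 + α + m.re) b
      (fun x => x * (((x ^ α : ℝ) : ℂ) * besselJ m ((ω * x : ℝ) : ℂ))) := by
  have hE : Differentiable ℂ fun z : ℂ => ((ω / 2 : ℝ) : ℂ) ^ m *
      ∑' n : ℕ, (-1 : ℂ) ^ n / ((n.factorial : ℂ) * Complex.Gamma (n + m + 1)) *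
        ((ω * z) / 2) ^ (2 * n) :=
    ((differentiable_besselJ_series m hm).comp
      (differentiable_id.const_mul (ω : ℂ))).const_mul _
  have h := (IsPowerSymbol.cpow b (1 + α + m)).mul (IsPowerSymbol.of_differentiable b hE)
  simp only [Complex.add_re, Complex.one_re, Complex.ofReal_re, add_zero] at h
  refine h.congr fun x hx => ?_
  have hx0 : (x : ℂ) ≠ 0 := by exact_mod_cast hx.ne'
  rw [Complex.cpow_add _ _ hx0, Complex.cpow_add _ _ hx0, Complex.cpow_one,
    Complex.ofReal_cpow hx.le, besselJ,
    show ((ω * x : ℝ) : ℂ) / 2 = ((ω / 2 : ℝ) : ℂ) * (x : ℂ) by push_cast; ring,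
    Complex.mul_cpow_ofReal_nonneg (by positivity) hx.le,
    show (ω * x : ℂ) / 2 = ((ω / 2 : ℝ) : ℂ) * (x : ℂ) by push_cast; ring]
  ring

theorem isPowerSymbol_log_besselJ_weight {b ω α γ : ℝ} {m : ℂ} (hω : 0 < ω)
    (hm : -1 < m.re) (hγ : γ < 1 + α + m.re) :
    IsPowerSymbol γ b
      (fun x => x * (((x ^ α * Real.log x : ℝ) : ℂ) * besselJ m ((ω * x : ℝ) : ℂ))) := by
  have h := ((isPowerSymbol_besselJ_weight (b := b) (α := α) hω hm).mul
    (IsPowerSymbol.log (sub_pos.2 hγ))).mono (δ := γ) (by linarith)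
  refine h.congr fun x _ => ?_
  push_cast
  ring

/-! ### Decay of the Chebyshev coefficients of `f`. -/

/-- The shape of the recursion which expresses Chebyshev coefficients `a` of a function by those
of its derivative, with decay `O(n ^ (-p))` of the latter. -/
def HasCoeffRecursion (a : ℕ → ℂ) (p : ℕ) : Prop :=
  ∃ (c : ℂ) (D : ℝ) (d : ℕ → ℂ),
    (∀ n : ℕ, ((n : ℂ) + 1) * a (n + 1) = c * (d n - d (n + 2))) ∧
    ∀ n : ℕ, ‖d n‖ ≤ D / ((n : ℝ) + 1) ^ p

theorem HasCoeffRecursion.norm_le {a : ℕ → ℂ} {p : ℕ} (h : HasCoeffRecursion a p) :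
    ∃ C, ∀ n : ℕ, ‖a n‖ ≤ C / ((n : ℝ) + 1) ^ (p + 1) := by
  obtain ⟨c, D, d, hrec, hd⟩ := h
  refine ⟨max ‖a 0‖ (2 ^ (p + 1) * (4 * ‖c‖ * D)), fun n => ?_⟩
  rcases n with _ | n
  · simp
  have hD : 0 ≤ D := by simpa using (norm_nonneg _).trans (hd 0)
  have h1 := norm_sum_Ico_le_of_telescoping a d c D p hrec hd (n + 1) (by omega) 1
  rw [Finset.sum_range_one, add_zero] at h1
  refine h1.trans ?_
  rw [div_le_div_iff₀ (by positivity) (by positivity)]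
  have h2 : (((n + 1 : ℕ) : ℝ) + 1) ^ (p + 1) ≤ 2 ^ (p + 1) * ((n + 1 : ℕ) : ℝ) ^ (p + 1) := by
    rw [← mul_pow]
    gcongr
    push_cast
    linarith [Nat.cast_nonneg (α := ℝ) n]
  calc 4 * ‖c‖ * D * (((n + 1 : ℕ) : ℝ) + 1) ^ (p + 1)
      ≤ 4 * ‖c‖ * D * (2 ^ (p + 1) * ((n + 1 : ℕ) : ℝ) ^ (p + 1)) := by gcongr
    _ = 2 ^ (p + 1) * (4 * ‖c‖ * D) * ((n + 1 : ℕ) : ℝ) ^ (p + 1) := by ring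
    _ ≤ _ := by gcongr; exact le_max_right _ _

/-- The induction descends from the derivative of order `k - 1`, whose own derivative is of bounded
variation with coefficients `O(1/n)`, to `f` itself at `i = k - 1`. Each integration gains one
power. -/
theorem HasBVDerivOfOrder.hasCoeffRecursion {k : ℕ} {b : ℝ} (hb : 0 < b) {f : ℝ → ℂ}
    (hf : HasBVDerivOfOrder k b f) (i : ℕ) (hi : i < k) :
    HasCoeffRecursion (cosCoeff b (iteratedDerivWithin (k - 1 - i) f (Icc 0 b))) (i + 1) := by
  have hu : UniqueDiffOn ℝ (Icc 0 b) := uniqueDiffOn_Icc hb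
  induction i with
  | zero =>
    obtain ⟨g, hg, hd⟩ := hf.boundedVariation
    obtain ⟨hint, C, hC⟩ := BoundedVariationOn.norm_cosCoeff_le b hb g hg
    set M := ‖g 0‖ + (eVariationOn g (Icc 0 b)).toReal
    have hM : ∀ x ∈ Icc 0 b, ‖g x‖ ≤ M := fun x hx => by
      have h1 := hg.dist_le hx (left_mem_Icc.2 hb.le)
      rw [dist_eq_norm] at h1
      have h2 := norm_le_norm_add_norm_sub' (g x) (g 0)
      linarith
    obtain ⟨-, hL⟩ := hf.absolutelyContinuous.integral_eq_sub_of_ae_hasDerivAt hb.le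
      ((ae_restrict_iff' measurableSet_Icc).1 hd) M hM
    exact ⟨_, C, _, cosCoeff_succ b hb _ g _ hL hd M hM hint, hC⟩
  | succ i ih =>
    obtain ⟨C, hC⟩ := (ih (by omega)).norm_le
    set j := k - 1 - (i + 1) with hj
    have hj1 : k - 1 - i = j + 1 := by omega
    rw [hj1] at hC
    have hjk : ((j + 1 : ℕ) : WithTop ℕ∞) ≤ ((k - 1 : ℕ) : ℕ∞) := by
      exact_mod_cast (by omega : j + 1 ≤ k - 1)
    have hcont := hf.contDiffOn.continuousOn_iteratedDerivWithin hjk hu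
    have hdiff := hf.contDiffOn.differentiableOn_iteratedDerivWithin
      (m := j) (lt_of_lt_of_le (by exact_mod_cast Nat.lt_succ_self j) hjk) hu
    have hder : ∀ x ∈ Icc 0 b, HasDerivWithinAt (iteratedDerivWithin j f (Icc 0 b))
        (iteratedDerivWithin (j + 1) f (Icc 0 b) x) (Icc 0 b) x := fun x hx => by
      rw [iteratedDerivWithin_succ]
      exact (hdiff x hx).hasDerivWithinAt
    obtain ⟨M, hM⟩ := isCompact_Icc.exists_bound_of_continuousOn hcont
    have hL := (convex_Icc 0 b).lipschitzOnWith_of_nnnorm_hasDerivWithin_le (C := M.toNNReal) hder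
      fun x hx => by
        rw [← NNReal.coe_le_coe, coe_nnnorm]
        exact (hM x hx).trans (Real.le_coe_toNNReal M)
    refine ⟨_, C, _, cosCoeff_succ b hb _ (iteratedDerivWithin (j + 1) f (Icc 0 b)) _ hL ?_ M hM
      (Continuous.intervalIntegrable
        (hcont.comp_continuous (continuous_angleNode b) (angleNode_mem b hb)) _ _), hC⟩
    rw [← restrict_Ioo_eq_restrict_Icc]
    filter_upwards [ae_restrict_mem measurableSet_Ioo] with x hx
      using (hder x (Ioo_subset_Icc_self hx)).hasDerivAt (Icc_mem_nhds hx.1 hx.2)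

/-! ### The error of product integration. -/

/-- Dominated convergence with majorant `∑ ‖a n‖ ‖w x‖`. The map `σ` is the identity for `f` and
`aliasIndex N` for its interpolant. -/
theorem hasSum_integral_mul_shiftedChebyshev {b : ℝ} (hb : 0 < b) {w g : ℝ → ℂ}
    (hw : IntervalIntegrable w volume 0 b) {a : ℕ → ℂ} (ha : Summable fun n => ‖a n‖) (σ : ℕ → ℕ)
    (hg : ∀ x ∈ Icc 0 b, HasSum (fun n => a n * (shiftedChebyshev b (σ n) x : ℂ)) (g x)) :
    HasSum (fun n => a n * chebyshevMoment b w (σ n)) (∫ x in (0 : ℝ)..b, w x * g x) := by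
  have hT : ∀ m, Continuous fun x => (shiftedChebyshev b m x : ℂ) := fun m =>
    Complex.continuous_ofReal.comp (continuous_shiftedChebyshev b m)
  have h := intervalIntegral.hasSum_integral_of_dominated_convergence (μ := volume) (a := 0) (b := b)
    (F := fun n x => a n * (w x * (shiftedChebyshev b (σ n) x : ℂ)))
    (f := fun x => w x * g x) (fun n x => ‖a n‖ * ‖w x‖) (fun n => ?_) (fun n => ?_) ?_ ?_ ?_
  · simpa only [chebyshevMoment, intervalIntegral.integral_const_mul] using h
  · rw [uIoc_of_le hb.le]
    exact ((hw.mul_continuousOn (hT _).continuousOn).const_mul (a n)).aestronglyMeasurable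
  · refine Filter.Eventually.of_forall fun x _ => ?_
    rw [norm_mul, norm_mul]
    gcongr
    exact mul_le_of_le_one_right (norm_nonneg _) (norm_shiftedChebyshev_le b _ x)
  · exact Filter.Eventually.of_forall fun x _ => ha.mul_right _
  · simp only [tsum_mul_right]
    exact hw.norm.const_mul _
  · refine Filter.Eventually.of_forall fun x hx => ?_
    rw [uIoc_of_le hb.le] at hx
    have := (hg x (Ioc_subset_Icc_self hx)).mul_left (w x)
    simpa only [mul_left_comm] using this

/-- The error of product integration in the Clenshaw-Curtis points, for a weight with an algebraic
or logarithmic singularity at `0`. -/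
theorem exists_norm_integral_sub_integral_ccInterpolant_le {b γ : ℝ} (hb : 0 < b) (h0 : 0 < γ)
    (h1 : γ < 1 / 2) {w : ℝ → ℂ} (hw : IsPowerSymbol γ b (fun x => x * w x)) {k : ℕ} (hk : 1 ≤ k)
    {f : ℝ → ℂ} (hf : HasBVDerivOfOrder k b f) :
    ∃ C, 0 ≤ C ∧ ∀ N : ℕ, 1 ≤ N →
      ‖(∫ x in (0 : ℝ)..b, w x * f x) -
        ∫ x in (0 : ℝ)..b, w x * (ccInterpolant b N f).eval (x : ℂ)‖ ≤ C / (N : ℝ) ^ (k + 1) := by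
  have hpi := Real.pi_pos
  have hint := IsPowerSymbol.intervalIntegrable_div hb h0 hw
  have hMsum := IsPowerSymbol.summable_norm_chebyshevMoment_sub hb h0 h1 hw
  have hrec := hf.hasCoeffRecursion hb (k - 1) (by omega)
  rw [Nat.sub_self, iteratedDerivWithin_zero, Nat.sub_add_cancel hk] at hrec
  have hsummable : Summable fun n => ‖cosCoeff b f n‖ := by
    obtain ⟨C, hC⟩ := hrec.norm_le
    have h2 : Summable fun n : ℕ => C * (1 / ((n : ℝ) + 1) ^ (k + 1)) := by
      refine Summable.mul_left C ?_
      have := (summable_nat_add_iff 1).2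
        (Real.summable_one_div_nat_pow.2 (show 1 < k + 1 by omega))
      exact_mod_cast this
    refine Summable.of_nonneg_of_le (fun _ => norm_nonneg _) (fun n => ?_) h2
    rw [mul_one_div]
    exact hC n
  have hsummable' : Summable fun n => ‖chebyshevCoeff b f n‖ := by
    refine Summable.of_nonneg_of_le (fun _ => norm_nonneg _) (fun n => ?_)
      (hsummable.mul_left (2 / Real.pi))
    rw [chebyshevCoeff, norm_mul, norm_div, Complex.norm_real, Real.norm_of_nonneg hpi.le]
    gcongr
    split_ifs <;> simp
  have hfc : ContinuousOn f (Icc 0 b) := hf.contDiffOn.continuousOn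
  have hseries : ∀ x ∈ Icc 0 b,
      HasSum (fun n => chebyshevCoeff b f n * (shiftedChebyshev b n x : ℂ)) (f x) := by
    intro x hx
    have := hasSum_cosCoeff b hb f hfc hsummable (Real.arccos (1 - 2 * x / b))
    rwa [angleNode_arccos b hb x hx] at this
  obtain ⟨c, D, d, hrec', hd⟩ := hrec
  set S := 2 / Real.pi * (4 * ‖c‖ * D) with hS
  set V := ∑' n, ‖chebyshevMoment b w (n + 1) - chebyshevMoment b w n‖ with hV
  set B := ∫ x in (0 : ℝ)..b, ‖w x‖ with hB
  have hD : 0 ≤ D := by simpa using (norm_nonneg _).trans (hd 0)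
  have hS0 : 0 ≤ S := by positivity
  have hV0 : 0 ≤ V := tsum_nonneg fun _ => norm_nonneg _
  have hB0 : 0 ≤ B := intervalIntegral.integral_nonneg hb.le fun _ _ => norm_nonneg _
  have hMB : ∀ n, ‖chebyshevMoment b w n‖ ≤ B := fun n => by
    refine intervalIntegral.norm_integral_le_of_norm_le hb.le
      (Filter.Eventually.of_forall fun x _ => ?_) hint.norm
    rw [norm_mul]
    exact mul_le_of_le_one_right (norm_nonneg _) (norm_shiftedChebyshev_le b n x)
  have hpartial : ∀ p, 1 ≤ p → ∀ l, ‖∑ n ∈ Finset.range l, chebyshevCoeff b f (p + n)‖ ≤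
      S / (p : ℝ) ^ (k + 1) := by
    intro p hp l
    have e : ∀ n, chebyshevCoeff b f (p + n) = 2 / (Real.pi : ℂ) * cosCoeff b f (p + n) :=
      fun n => by rw [chebyshevCoeff, if_neg (by omega)]
    simp only [e]
    rw [← Finset.mul_sum, norm_mul, norm_div, Complex.norm_real, Complex.norm_ofNat,
      Real.norm_of_nonneg hpi.le, hS, mul_div_assoc]
    gcongr
    exact norm_sum_Ico_le_of_telescoping _ d c D k hrec' hd p hp l
  refine ⟨S * (2 * B + 2 * V) * (∑' p : ℕ, 1 / (p : ℝ) ^ 2), ?_, fun N hN => ?_⟩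
  · have : 0 ≤ ∑' p : ℕ, 1 / (p : ℝ) ^ 2 := tsum_nonneg fun _ => by positivity
    positivity
  have hI := (hasSum_integral_mul_shiftedChebyshev hb hint hsummable' id hseries).sub
    (hasSum_integral_mul_shiftedChebyshev hb hint hsummable' (aliasIndex N)
      (hasSum_ccInterpolant b hb N hN f _ hseries))
  simp only [id, ← mul_sub] at hI
  -- Convergence of the error series allows passing to partial sums over complete blocks of length
  -- `N`.
  have hlim := hI.tendsto_sum_nat.comp
    (Filter.tendsto_id.atTop_mul_const' (show 0 < N from hN))
  refine le_of_tendsto hlim.norm (Filter.Eventually.of_forall fun Q => ?_)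
  exact norm_sum_range_mul_sub_aliasIndex_le _ _ S V B k N hk hN hpartial hMB hMsum le_rfl Q

end

theorem theorem3p3 (b α ω : ℝ) (m : ℂ) (hb : 0 < b) (hα : -1 < α) (hω : 0 < ω)
    (hm : -1 < m.re) (hαm : -1 < α + m.re)
    (k : ℕ) (hk : 1 ≤ k) (f : ℝ → ℂ) (hf : HasBVDerivOfOrder k b f) :
    (α < -1 / 2 → ∃ C : ℝ, ∀ N : ℕ, k ≤ N →
      ‖besselTransform b α ω m f - ccf b α ω m N f‖ ≤ C / (N : ℝ) ^ ((k : ℝ) + 2 * α + 2)) ∧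
    (-1 / 2 ≤ α → ∃ C : ℝ, ∀ N : ℕ, k ≤ N →
      ‖besselTransform b α ω m f - ccf b α ω m N f‖ ≤ C / (N : ℝ) ^ (k + 1)) ∧
    (α < -1 / 2 → ∃ C : ℝ, ∀ N : ℕ, k ≤ N → 2 ≤ N →
      ‖besselLogTransform b α ω m f - ccfLog b α ω m N f‖ ≤
        C * Real.log N / (N : ℝ) ^ ((k : ℝ) + 2 * α + 2)) ∧
    (α = -1 / 2 → ∃ C : ℝ, ∀ N : ℕ, k ≤ N → 2 ≤ N →
      ‖besselLogTransform b α ω m f - ccfLog b α ω m N f‖ ≤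
        C * Real.log N / (N : ℝ) ^ (k + 1)) ∧
    (-1 / 2 < α → ∃ C : ℝ, ∀ N : ℕ, k ≤ N →
      ‖besselLogTransform b α ω m f - ccfLog b α ω m N f‖ ≤ C / (N : ℝ) ^ (k + 1)) := by
  -- `γ < 1/2` keeps the order `2γ` in the angle below `1`; `γ < 1 + α + Re m` leaves room for the
  -- logarithm.
  obtain ⟨γ, hγ0, hγ⟩ := exists_between (show 0 < min (1 / 2) (1 + α + m.re) from
    lt_min (by norm_num) (by linarith))
  obtain ⟨hγ1, hγ2⟩ := lt_min_iff.1 hγ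
  obtain ⟨C, hC0, hC⟩ := exists_norm_integral_sub_integral_ccInterpolant_le hb hγ0 hγ1
    ((isPowerSymbol_besselJ_weight (α := α) hω hm).mono hγ2.le) hk hf
  obtain ⟨D, hD0, hD⟩ := exists_norm_integral_sub_integral_ccInterpolant_le hb hγ0 hγ1
    (isPowerSymbol_log_besselJ_weight hω hm hγ2) hk hf
  have h1 : ∀ N : ℕ, k ≤ N →
      ‖besselTransform b α ω m f - ccf b α ω m N f‖ ≤ C / (N : ℝ) ^ (k + 1) := fun N hN => by
    simpa only [ccf, besselTransform, mul_right_comm] using hC N (hk.trans hN)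
  have h2 : ∀ N : ℕ, k ≤ N →
      ‖besselLogTransform b α ω m f - ccfLog b α ω m N f‖ ≤ D / (N : ℝ) ^ (k + 1) := fun N hN => by
    simpa only [ccfLog, besselLogTransform, mul_right_comm] using hD N (hk.trans hN)
  have hpow : α < -1 / 2 → ∀ N : ℕ, k ≤ N →
      (N : ℝ) ^ ((k : ℝ) + 2 * α + 2) ≤ (N : ℝ) ^ (k + 1) := fun hα' N hN => by
    rw [← Real.rpow_natCast]
    refine Real.rpow_le_rpow_of_exponent_le (by exact_mod_cast hk.trans hN) ?_
    push_cast
    linarith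
  have hlog2 : 0 < Real.log 2 := Real.log_pos one_lt_two
  have hlog : ∀ N : ℕ, 2 ≤ N → D ≤ D / Real.log 2 * Real.log N := fun N hN => by
    have : Real.log 2 ≤ Real.log N := Real.log_le_log two_pos (by exact_mod_cast hN)
    rw [div_mul_eq_mul_div, le_div_iff₀ hlog2]
    gcongr
  have hNpos : ∀ N : ℕ, k ≤ N → (0 : ℝ) < N := fun N hN => by exact_mod_cast hk.trans hN
  refine ⟨fun hα' => ⟨C, fun N hN => (h1 N hN).trans ?_⟩, fun _ => ⟨C, h1⟩,
    fun hα' => ⟨D / Real.log 2, fun N hN hN2 => (h2 N hN).trans ?_⟩,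
    fun _ => ⟨D / Real.log 2, fun N hN hN2 => (h2 N hN).trans ?_⟩, fun _ => ⟨D, h2⟩⟩
  · have := hNpos N hN
    have := hpow hα' N hN
    gcongr
  · exact div_le_div₀ (hD0.trans (hlog N hN2)) (hlog N hN2)
      (Real.rpow_pos_of_pos (hNpos N hN) _) (hpow hα' N hN)
  · have := hNpos N hN
    have := hlog N hN2
    gcongr
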